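/- Let $V=H^1(\mathbb R^3)$ (real-valued functions), $V'=H^{-1}(\mathbb R^3)$ its dual, $\langle\cdot,\cdot\rangle$ the $L^2(\mathbb R^3)$ inner product and its extension to $V'\times V$, and $N,M\in\mathbb N$, $Z_\nu\in\mathbb R$, $R_\nu\in\mathbb R^3$ ($1\le\nu\le M$). Put $V_{nuc}(x)=-\sum_{\nu=1}^M Z_\nu/\|x-R_\nu\|$. For $\Phi=(\varphi_1,\dots,\varphi_N)\in V^N$ put $$\rho_\Phi(x,y)=\sum_{i=1}^N\varphi_i(x)\varphi_i(y),\qquad n_\Phi(x)=\rho_\Phi(x,x),$$ $$\mathcal J_{HF}(\Phi)=\sum_{i=1}^N\int\Big(\tfrac12|\nabla\varphi_i(x)|^2+V_{nuc}(x)|\varphi_i(x)|^2+\tfrac12\sum_{j=1}^N\int\frac{|\varphi_j(y)|^2}{\|x-y\|}dy\,|\varphi_i(x)|^2-\tfrac12\sum_{j=1}^N\int\frac{\varphi_i(x)\varphi_j(x)\varphi_j(y)\varphi_i(y)}{\|x-y\|}dy\Big)dx,$$ $$\mathcal J_{KS}(\Phi)=\tfrac12\sum_{i=1}^N\int|\nabla\varphi_i|^2+\int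 n_\Phi V_{nuc}+\tfrac12\iint\frac{n_\Phi(x)n_\Phi(y)}{\|x-y\|}dx\,dy+E_{xc}(n_\Phi).$$ For a functional $\mathcal J$ on $V^N$ let $\mathcal J'(\Phi)\in(V')^N$ denote one half of its Fréchet derivative, i.e. $D\mathcal J(\Phi)[\delta\Phi]=2\sum_i\langle(\mathcal J'(\Phi))_i,\delta\varphi_i\rangle$. For $A:V\to V'$ put $\mathcal A\Phi=(A\varphi_1,\dots,A\varphi_N)$, and for a matrix $\mathbf M$ put $(\Phi\mathbf M)_j=\sum_i m_{ij}\varphi_i$. Call $\Phi$ orthonormal if $\langle\varphi_i,\varphi_j\rangle=\delta_{ij}$. A minimizer of $\mathcal J$ is a minimizer over the orthonormal $\Phi\in V^N$. (0) All Coulomb integrals above and below exist, and if $\Phi$ is orthonormal with Slater determinant $\psi_{SL}^\Phi(x_1,\dots,x_N)=(N!)^{-1/2}\det(\varphi_i(x_j))$, then $\rho_\Phi(x,y)=N\int\psi_{SL}^\Phi(x,x_2,\dots,x_N)\,\psi_{SL}^\Phi(y,x_2,\dots,x_N)\,dx_2\cdots dx_N$. (1) $\mathcal J_{HF}$ is Fréchet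 differentiable on $V^N$ and $\mathcal J_{HF}'(\Phi)=\mathcal A_\Phi\Phi$, where $A_\Phi=F^{HF}_\Phi:V\to V'$ is the bounded linear operator (Fock operator) $$F^{HF}_\Phi\varphi(x)=-\tfrac12\Delta\varphi(x)+V_{nuc}(x)\varphi(x)+\int\frac{n_\Phi(y)}{\|x-y\|}dy\,\varphi(x)-\int\frac{\rho_\Phi(x,y)\varphi(y)}{\|x-y\|}dy.$$ (2) Assume that $E_{xc}$ is Fréchet differentiable on the set of non-negative $n\in L^1(\mathbb R^3)\cap L^3(\mathbb R^3)$, relative to this set and with respect to the norm of $L^1\cap L^3$, with derivative $v_{xc}(n)\in L^\infty+L^{3/2}=(L^1\cap L^3)'$. Then $\mathcal J_{KS}$ is Fréchet differentiable on $V^N$ and $\mathcal J_{KS}'(\Phi)=\mathcal A_\Phi\Phi$, where $A_\Phi=F^{KS}_{n}:V\to V'$, $n=n_\Phi$, is the bounded linear operator (Kohn–Sham Hamiltonian) $$F^{KS}_n\varphi=-\tfrac12\Delta\varphi+V_{nuc}\varphi+\Big(n\star\frac1{\|\cdot\|}\Big)\varphi+v_{xc}(n)\varphi.$$ (3) In both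 cases let $\Psi=(\psi_1,\dots,\psi_N)$ be a minimizer of $\mathcal J$. The Lagrange multiplier, i.e. the matrix $\Lambda\in\mathbb R^{N\times N}$ with $\mathcal J'(\Psi)-(\sum_k\lambda_{ik}\psi_k)_{i=1}^N=0$ in $(V')^N$, exists, is unique and is given by $\lambda_{ij}=\langle A_\Psi\psi_i,\psi_j\rangle$. There are $\mathbf U\in O(N)$ and $\lambda_1,\dots,\lambda_N\in\mathbb R$ such that $\tilde\Psi=\Psi\mathbf U=(\tilde\psi_1,\dots,\tilde\psi_N)$ is again an orthonormal minimizer, $A_{\tilde\Psi}=A_\Psi$, the Lagrange multiplier at $\tilde\Psi$ is $\mathrm{diag}(\lambda_1,\dots,\lambda_N)$, $\langle A_\Psi\tilde\psi_i,\tilde\psi_j\rangle=\lambda_i\delta_{ij}$, and the nonlinear eigenvalue equations $A_{\tilde\Psi}\tilde\psi_i=\lambda_i\tilde\psi_i$ hold in $V'$ for $i=1,\dots,N$ (the Hartree–Fock equations $F^{HF}_{\tilde\Psi}\tilde\psi_i=\lambda_i\tilde\psi_i$, resp. the Kohn–Sham equations $F^{KS}_n\tilde\psi_i=\lambda_i\tilde\psi_i$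 with $n=n_{\tilde\Psi}$). -/

import Mathlib

open MeasureTheory Set Filter Topology
open scoped ENNReal ContDiff Matrix

noncomputable section

namespace HFKS

/-! ### The Gelfand triple `H¹(ℝ³) ⊂ L²(ℝ³) ⊂ H⁻¹(ℝ³)` (real-valued functions) -/

/-- Physical space `ℝ³` with the Euclidean norm. -/
abbrev E3 := EuclideanSpace ℝ (Fin 3)

/-- Real-valued `L²(ℝ³)`. -/
abbrev L2 := Lp ℝ 2 (volume : Measure E3)

/-- Square-integrable vector fields on `ℝ³`. -/
abbrev L2Vec := Lp E3 2 (volume : Measure E3)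

/-- `G` is the weak gradient of `u`: `∫ u ∂ₖf = - ∫ Gₖ f` for all test functions `f` and `k = 1,2,3`. -/
def IsWeakGradient (u : E3 → ℝ) (G : E3 → E3) : Prop :=
  ∀ f : E3 → ℝ, ContDiff ℝ ∞ f → HasCompactSupport f → ∀ k : Fin 3,
    ∫ x, u x * fderiv ℝ f x (EuclideanSpace.single k 1) = - ∫ x, G x k * f x

theorem integrable_mul_of_memLp {f g : E3 → ℝ} (hf : MemLp f 2 volume) (hg : MemLp g 2 volume) :
    Integrable (fun x => f x * g x) volume :=
  hf.integrable_mul hg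

theorem memLp_test {f : E3 → ℝ} (hf : ContDiff ℝ ∞ f) (hc : HasCompactSupport f) :
    MemLp f 2 volume :=
  hf.continuous.memLp_of_hasCompactSupport hc

theorem memLp_test_deriv {f : E3 → ℝ} (hf : ContDiff ℝ ∞ f) (hc : HasCompactSupport f) (v : E3) :
    MemLp (fun x => fderiv ℝ f x v) 2 volume := by
  refine Continuous.memLp_of_hasCompactSupport ?_ (hc.fderiv_apply ℝ v)
  exact (hf.continuous_fderiv (by simp)).clm_apply continuous_const

theorem memLp_coord (G : L2Vec) (k : Fin 3) : MemLp (fun x => G x k) 2 volume := by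
  have h := (Lp.memLp G).const_inner (𝕜 := ℝ) (EuclideanSpace.single k (1 : ℝ))
  simpa [EuclideanSpace.inner_single_left] using h

/-- The Sobolev space `H¹(ℝ³)`: pairs `(u, ∇u)` consisting of an `L²` function and its `L²` weak
gradient, with the norm `(‖u‖² + ‖∇u‖²)^(1/2)` inherited from `L² × (L²)³`. The second component is
determined by the first one. -/
def sobolevH1 : Submodule ℝ (WithLp 2 (L2 × L2Vec)) where
  carrier := {p | IsWeakGradient p.fst p.snd}
  zero_mem' := by
    intro f hf hc k
    have h1 : (fun x => ((0 : WithLp 2 (L2 × L2Vec)).fst : E3 → ℝ) x *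
        fderiv ℝ f x (EuclideanSpace.single k 1)) =ᵐ[volume] fun _ => (0 : ℝ) := by
      filter_upwards with x
      simp
    have h2 : (fun x => ((0 : WithLp 2 (L2 × L2Vec)).snd : E3 → E3) x k * f x)
        =ᵐ[volume] fun _ => (0 : ℝ) := by
      filter_upwards with x
      simp
    rw [integral_congr_ae h1, integral_congr_ae h2]
    simp
  add_mem' := by
    intro p q hp hq f hf hc k
    have h1 : (fun x => ((p + q).fst : E3 → ℝ) x * fderiv ℝ f x (EuclideanSpace.single k 1))
        =ᵐ[volume] fun x => p.fst x * fderiv ℝ f x (EuclideanSpace.single k 1)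
          + q.fst x * fderiv ℝ f x (EuclideanSpace.single k 1) := by
      filter_upwards [Lp.coeFn_add p.fst q.fst] with x hx
      simp only [WithLp.add_fst, hx, Pi.add_apply, add_mul]
    have h2 : (fun x => ((p + q).snd : E3 → E3) x k * f x)
        =ᵐ[volume] fun x => p.snd x k * f x + q.snd x k * f x := by
      filter_upwards [Lp.coeFn_add p.snd q.snd] with x hx
      simp only [WithLp.add_snd, hx, Pi.add_apply, PiLp.add_apply, add_mul]
    rw [integral_congr_ae h1, integral_congr_ae h2,
      integral_add (integrable_mul_of_memLp (Lp.memLp _) (memLp_test_deriv hf hc _))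
        (integrable_mul_of_memLp (Lp.memLp _) (memLp_test_deriv hf hc _)),
      integral_add (integrable_mul_of_memLp (memLp_coord _ k) (memLp_test hf hc))
        (integrable_mul_of_memLp (memLp_coord _ k) (memLp_test hf hc)),
      hp f hf hc k, hq f hf hc k]
    ring
  smul_mem' := by
    intro c p hp f hf hc k
    have h1 : (fun x => ((c • p).fst : E3 → ℝ) x * fderiv ℝ f x (EuclideanSpace.single k 1))
        =ᵐ[volume] fun x => c * (p.fst x * fderiv ℝ f x (EuclideanSpace.single k 1)) := by
      filter_upwards [Lp.coeFn_smul c p.fst] with x hx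
      simp [hx, mul_assoc]
    have h2 : (fun x => ((c • p).snd : E3 → E3) x k * f x)
        =ᵐ[volume] fun x => c * (p.snd x k * f x) := by
      filter_upwards [Lp.coeFn_smul c p.snd] with x hx
      simp [hx, mul_assoc]
    rw [integral_congr_ae h1, integral_congr_ae h2, integral_const_mul, integral_const_mul,
      hp f hf hc k]
    ring

/-- `V = H¹(ℝ³)`, with the Hilbert space structure inherited from `L² × (L²)³`. -/
abbrev H1 := ↥sobolevH1

/-- `V' = H⁻¹(ℝ³)`, the topological dual of `V`. -/
abbrev Hneg1 := StrongDual ℝ H1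

/-- A representative of the function `φ ∈ H¹(ℝ³)`. -/
instance : CoeFun H1 (fun _ => E3 → ℝ) := ⟨fun φ => (φ.1.fst : E3 → ℝ)⟩

/-- A representative of the weak gradient of `φ ∈ H¹(ℝ³)`. -/
def grad (φ : H1) : E3 → E3 := φ.1.snd

/-- The inclusion `V ⊂ L² ⊂ V'`, `φ ↦ ⟨φ, ·⟩`, given by the `L²` inner product. -/
def toDual (φ : H1) : Hneg1 :=
  (innerSL ℝ φ.1.fst).comp ((WithLp.fstL 2 ℝ L2 L2Vec).comp sobolevH1.subtypeL)

theorem toDual_apply (φ η : H1) : toDual φ η = ∫ x, φ x * η x := by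
  change inner ℝ φ.1.fst η.1.fst = _
  rw [L2.inner_def]
  simp [mul_comm]

variable {N M : ℕ}

/-! ### Stiefel manifold, gradients, right multiplication by matrices

`Vᴺ` is `Fin N → H1`, and `(V')ᴺ` is `Fin N → Hneg1`. -/

/-- The Stiefel manifold: `L²`-orthonormal `N`-tuples in `V`. -/
def stiefel (N : ℕ) : Set (Fin N → H1) :=
  {Φ | ∀ i j, ∫ x, Φ i x * Φ j x = if i = j then 1 else 0}

/-- `(Φ M)ⱼ = ∑ᵢ mᵢⱼ φᵢ`. -/
def rightMul (Φ : Fin N → H1) (U : Matrix (Fin N) (Fin N) ℝ) : Fin N → H1 :=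
  fun j => ∑ i, U i j • Φ i

/-- The gradient `J'(Φ) ∈ (V')ᴺ`, in the normalisation `J' = ½ DJ` with `DJ` the Fréchet
derivative; this is the derivative of the part `½ J` of the Lagrangian
`½ (J(Φ) - ∑ λᵢⱼ (⟨φᵢ, φⱼ⟩ - δᵢⱼ))`. -/
def gradient (J : (Fin N → H1) → ℝ) (Φ : Fin N → H1) : Fin N → Hneg1 :=
  fun i => (1 / 2 : ℝ) •
    (fderiv ℝ J Φ).comp (ContinuousLinearMap.single ℝ (fun _ : Fin N => H1) i)

/-- The extension `𝓐 = A ⊗ I : Vᴺ → (V')ᴺ` of an operator `A : V → V'`. -/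
def extend (A : H1 →L[ℝ] Hneg1) (Φ : Fin N → H1) : Fin N → Hneg1 :=
  fun i => A (Φ i)

/-- `Λ` is a Lagrange multiplier of `J` at `Ψ`: `J'(Ψ) - (∑ₖ λᵢₖ ψₖ)ᵢ = 0` in `(V')ᴺ`. -/
def IsLagrangeMultiplier (J : (Fin N → H1) → ℝ) (Ψ : Fin N → H1)
    (Λ : Matrix (Fin N) (Fin N) ℝ) : Prop :=
  ∀ i, gradient J Ψ i - ∑ k, Λ i k • toDual (Ψ k) = 0

/-! ### Densities, potentials and energies -/

/-- `V(x) = -∑ Z_ν / |x - R_ν|`. -/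
def nuclearPotential (Z : Fin M → ℝ) (R : Fin M → E3) (x : E3) : ℝ :=
  -∑ ν, Z ν / ‖x - R ν‖

/-- The Slater determinant `(N!)^(-1/2) det (φᵢ(xⱼ))`. -/
def slater (Φ : Fin N → H1) (x : Fin N → E3) : ℝ :=
  (1 / √(N.factorial : ℝ)) * (Matrix.of fun i j => Φ i (x j)).det

/-- `N ∫ ψ_SL(x, x₂, …, x_N) ψ_SL(y, x₂, …, x_N) dx₂ ⋯ dx_N` (and `0` for `N = 0`). -/
def slaterDensityMatrix : {N : ℕ} → (Fin N → H1) → E3 → E3 → ℝ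
  | 0, _, _, _ => 0
  | n + 1, Φ, x, y =>
      ((n + 1 : ℕ) : ℝ) * ∫ z : Fin n → E3, slater Φ (Fin.cons x z) * slater Φ (Fin.cons y z)

/-- The density matrix `ρ_Φ(x,y) = ∑ᵢ φᵢ(x) φᵢ(y)`. -/
def densityMatrix (Φ : Fin N → H1) (x y : E3) : ℝ := ∑ i, Φ i x * Φ i y

/-- The electron density `n_Φ(x) = ρ_Φ(x,x) = ∑ᵢ |φᵢ(x)|²`. -/
def density (Φ : Fin N → H1) (x : E3) : ℝ := densityMatrix Φ x x

theorem aestronglyMeasurable_density (Φ : Fin N → H1) :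
    AEStronglyMeasurable (density Φ) volume := by
  unfold density densityMatrix
  refine Finset.aestronglyMeasurable_fun_sum _ fun i _ => ?_
  exact (Lp.aestronglyMeasurable _).mul (Lp.aestronglyMeasurable _)

/-- The electron density as an a.e.-equivalence class of functions. -/
def densityClass (Φ : Fin N → H1) : E3 →ₘ[volume] ℝ :=
  AEEqFun.mk (density Φ) (aestronglyMeasurable_density Φ)

/-- The Coulomb potential `(f ⋆ 1/|·|)(x) = ∫ f(y) / |x - y| dy`. -/
def coulomb (f : E3 → ℝ) (x : E3) : ℝ := ∫ y, f y / ‖x - y‖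

/-- The exchange term `∫ ρ_Φ(x,y) φ(y) / |x - y| dy`. -/
def exchange (Φ : Fin N → H1) (φ : H1) (x : E3) : ℝ :=
  ∫ y, densityMatrix Φ x y * φ y / ‖x - y‖

/-- The integrand (in `x`) of the `i`-th summand of the closed-shell Hartree–Fock functional. -/
def hfIntegrand (Z : Fin M → ℝ) (R : Fin M → E3) (Φ : Fin N → H1) (i : Fin N) (x : E3) : ℝ :=
  1 / 2 * ‖grad (Φ i) x‖ ^ 2 + nuclearPotential Z R x * |Φ i x| ^ 2
    + 1 / 2 * (∑ j, (∫ y, |Φ j y| ^ 2 / ‖x - y‖) * |Φ i x| ^ 2)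
    - 1 / 2 * (∑ j, ∫ y, Φ i x * Φ j x * Φ j y * Φ i y / ‖x - y‖)

/-- The closed-shell (restricted) Hartree–Fock functional. -/
def hartreeFock (Z : Fin M → ℝ) (R : Fin M → E3) (Φ : Fin N → H1) : ℝ :=
  ∑ i, ∫ x, hfIntegrand Z R Φ i x

/-- The Kohn–Sham functional with exchange-correlation energy `Exc`. -/
def kohnSham (Z : Fin M → ℝ) (R : Fin M → E3) (Exc : (E3 →ₘ[volume] ℝ) → ℝ)
    (Φ : Fin N → H1) : ℝ :=
  1 / 2 * (∑ i, ∫ x, ‖grad (Φ i) x‖ ^ 2)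
    + (∫ x, density Φ x * nuclearPotential Z R x)
    + 1 / 2 * (∫ x, ∫ y, density Φ x * density Φ y / ‖x - y‖)
    + Exc (densityClass Φ)

/-! ### Differentiability of the exchange-correlation energy -/

/-- The norm of `L¹(ℝ³) ∩ L³(ℝ³)`. -/
def normL1L3 (h : E3 → ℝ) : ℝ :=
  (eLpNorm h 1 volume).toReal + (eLpNorm h 3 volume).toReal

/-- The densities: non-negative elements of `L¹(ℝ³) ∩ L³(ℝ³)`. -/
def densities : Set (E3 →ₘ[volume] ℝ) :=
  {n | 0 ≤ n ∧ MemLp n 1 volume ∧ MemLp n 3 volume}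

/-- `v` lies in `L^∞(ℝ³) + L^{3/2}(ℝ³)`, the dual space of `L¹(ℝ³) ∩ L³(ℝ³)`. -/
def MemDual (v : E3 → ℝ) : Prop :=
  ∃ v₁ v₂ : E3 → ℝ, MemLp v₁ ∞ volume ∧ MemLp v₂ (3 / 2) volume ∧ v = v₁ + v₂

/-- `v ∈ L^∞ + L^{3/2}` is the (Fréchet) derivative of `Exc` at the density `n`, with respect to the
norm of `L¹ ∩ L³` on the set of densities:
`Exc(m) = Exc(n) + ∫ v (m - n) + o(‖m - n‖)` as `m → n` among the densities. -/
def HasXcDerivAt (Exc : (E3 →ₘ[volume] ℝ) → ℝ) (v : E3 → ℝ) (n : E3 →ₘ[volume] ℝ) : Prop :=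
  MemDual v ∧ ∀ ε > 0, ∃ δ > 0, ∀ m ∈ densities,
    normL1L3 (m - n : E3 →ₘ[volume] ℝ) ≤ δ →
      |Exc m - Exc n - ∫ x, v x * (m - n : E3 →ₘ[volume] ℝ) x|
        ≤ ε * normL1L3 (m - n : E3 →ₘ[volume] ℝ)

/-! ### The Fock operator and the Kohn–Sham Hamiltonian -/

/-- `A : V → V'` is the operator `A φ = -½ Δ φ + W φ`, where `W` sends `φ ∈ V` to a
function: the products `(W φ) η` are integrable and
`⟨A φ, η⟩ = ½ ∫ ∇φ · ∇η + ∫ (W φ) η` for all `φ, η ∈ V`. -/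
def IsSchrodingerOperator (W : H1 → E3 → ℝ) (A : H1 →L[ℝ] Hneg1) : Prop :=
  ∀ φ η : H1, Integrable (fun x => W φ x * η x) volume ∧
    A φ η = 1 / 2 * (∫ x, inner ℝ (grad φ x) (grad η x)) + (∫ x, W φ x * η x)

/-- `A` is the Fock operator
`F_Φ φ = -½ Δφ + V φ + (∫ n_Φ(y)/|x-y| dy) φ - ∫ ρ_Φ(x,y) φ(y)/|x-y| dy`. -/
def IsFockOperator (Z : Fin M → ℝ) (R : Fin M → E3) (Φ : Fin N → H1)
    (A : H1 →L[ℝ] Hneg1) : Prop :=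
  IsSchrodingerOperator (fun φ x => nuclearPotential Z R x * φ x
    + coulomb (density Φ) x * φ x - exchange Φ φ x) A

/-- `A` is the Kohn–Sham Hamiltonian
`F_n φ = -½ Δφ + V φ + (n ⋆ 1/|·|) φ + v φ`, with `n = n_Φ`. -/
def IsKohnShamOperator (Z : Fin M → ℝ) (R : Fin M → E3) (v : E3 → ℝ) (Φ : Fin N → H1)
    (A : H1 →L[ℝ] Hneg1) : Prop :=
  IsSchrodingerOperator (fun φ x => nuclearPotential Z R x * φ x
    + coulomb (density Φ) x * φ x + v x * φ x) A

/-- `J` is differentiable on `Vᴺ` with gradient `J'(Φ) = 𝓐_Φ Φ`. -/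
def HasGradientOperator (J : (Fin N → H1) → ℝ) (A : (Fin N → H1) → H1 →L[ℝ] Hneg1) : Prop :=
  ∀ Φ, DifferentiableAt ℝ J Φ ∧ gradient J Φ = extend (A Φ) Φ

/-- The conclusions at a minimizer `Ψ` of `J` on the Stiefel manifold: the Lagrange multiplier is
unique and equals `(⟨A_Ψ ψᵢ, ψⱼ⟩)ᵢⱼ`; and there is an orthogonal `U` such that `Ψ̃ = Ψ U` is again an
orthonormal minimizer, `A_Ψ̃ = A_Ψ`, the multiplier is diagonal for `Ψ̃`, and the functions
`ψ̃ᵢ` solve the nonlinear eigenvalue equations `A_Ψ̃ ψ̃ᵢ = λᵢ ψ̃ᵢ` in `V'`. -/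
def CanonicalEquations (J : (Fin N → H1) → ℝ) (A : (Fin N → H1) → H1 →L[ℝ] Hneg1) : Prop :=
  ∀ Ψ ∈ stiefel N, IsMinOn J (stiefel N) Ψ →
    (∀ Λ : Matrix (Fin N) (Fin N) ℝ,
      IsLagrangeMultiplier J Ψ Λ ↔ Λ = Matrix.of fun i j => A Ψ (Ψ i) (Ψ j)) ∧
    ∃ U ∈ Matrix.orthogonalGroup (Fin N) ℝ, ∃ l : Fin N → ℝ,
      rightMul Ψ U ∈ stiefel N ∧
      IsMinOn J (stiefel N) (rightMul Ψ U) ∧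
      A (rightMul Ψ U) = A Ψ ∧
      IsLagrangeMultiplier J (rightMul Ψ U) (Matrix.diagonal l) ∧
      (∀ i j, A Ψ (rightMul Ψ U i) (rightMul Ψ U j) = if i = j then l i else 0) ∧
      (∀ i, A (rightMul Ψ U) (rightMul Ψ U i) = l i • toDual (rightMul Ψ U i))

end HFKS

end

/-!
The functionals are polynomials of degree at most four in the orbitals, apart from `E_xc`, so that
everything rests on the boundedness of a few multilinear forms on `V = H¹(ℝ³)`.

*Boundedness.* Mollification and truncation of `φ ∈ H¹`, the Gagliardo-Nirenberg-Sobolev inequality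
for `C¹_c` functions and Fatou's lemma give `‖φ‖_{L⁶} ≤ C ‖φ‖_{H¹}` (`exists_eLpNorm_six_le`). Hence
products of two `H¹` functions lie in `L¹ ∩ L³`, and Hölder's inequality makes
`(φ, η) ↦ ∫ v φ η` a bounded form for every `v ∈ L^∞ + L^{3/2}`. As `1/|·|` is such a function, the
Coulomb potential of `φ η` is bounded, uniformly in space (`exists_coulomb_mul_bound`), and the
Coulomb energy is a bounded quadrilinear form (`isBoundedQuadrilinear_coulombForm`), symmetric in
its two charge densities by Fubini's theorem (`coulombForm_comm`).

*Gradients.* With these symmetries the gradient of `orbitalEnergy`, which covers Hartree–Fock theory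
and the explicit part of the Kohn–Sham functional, comes out as `A_Φ Φ`
(`exists_orbitalEnergy_gradient`). For `E_xc` one has `n_{Φ+h} - n_Φ = ∑ᵢ (2φᵢ + hᵢ) hᵢ`, which is
`O(‖h‖)` in `L¹ ∩ L³`, so that `E_xc(n_Φ)` agrees to first order with the quadratic functional
`∑ᵢ ∫ v_xc φᵢ²` (`hasGradientAt_exc`).

*Minimizers.* If `η` is `L²`-orthogonal to the orthonormal minimizer `Ψ`, then replacing `ψᵢ` by
`(ψᵢ + t η) / (1 + t² ‖η‖²)^{1/2}` gives a curve of orthonormal tuples, whence `⟨A_Ψ ψᵢ, η⟩ = 0`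
and `A_Ψ ψᵢ = ∑ₖ ⟨A_Ψ ψᵢ, ψₖ⟩ ψₖ`. Since `A_Ψ` is symmetric, the spectral theorem diagonalises the
multiplier by an orthogonal matrix, and the functional and `A_Ψ` are invariant under orthogonal
transformations of `Ψ` (`canonicalEquations_of_invariant`).

The formula for the density matrix of the Slater determinant is the expansion of both determinants
over permutations (`slaterDensityMatrix_eq`).
-/

open MeasureTheory Set Filter Topology
open scoped ENNReal ContDiff Matrix

namespace HFKS

-- The default depth is too small for instances on iterated spaces of continuous linear maps.
set_option maxSynthPendingDepth 3

/-! ### Mollification and the Sobolev inequality on `H¹(ℝ³)` -/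

/-- Jensen's inequality for averages, integrated: convolution with a probability density does not
increase the `L²` norm. -/
theorem lintegral_convolution_rpow_two_le {k g : E3 → ℝ≥0∞} (hk : Measurable k)
    (hg : AEMeasurable g volume) (hk1 : ∫⁻ y, k y = 1) :
    ∫⁻ x, (∫⁻ y, k (x - y) * g y) ^ (2 : ℝ) ≤ ∫⁻ y, g y ^ (2 : ℝ) := by
  have hkx (x : E3) : Measurable fun y => k (x - y) := hk.comp (measurable_const.sub measurable_id)
  have h1 (x : E3) : ∫⁻ y, k (x - y) = 1 := by
    rw [lintegral_sub_left_eq_self (μ := volume) k x, hk1]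
  have h2 (x : E3) : (∫⁻ y, k (x - y) * g y) ^ (2 : ℝ) ≤ ∫⁻ y, k (x - y) * g y ^ (2 : ℝ) := by
    set μ : Measure E3 := volume.withDensity fun y => k (x - y) with hμ
    have hac : μ ≪ volume := withDensity_absolutelyContinuous _ _
    have := ENNReal.lintegral_mul_le_Lp_mul_Lq μ Real.HolderConjugate.two_two
      (f := fun _ => 1) (g := g) aemeasurable_const (hg.mono_ac hac)
    have hone : ∫⁻ _, 1 ∂μ = 1 := by
      rw [hμ, lintegral_one, withDensity_apply _ MeasurableSet.univ, setLIntegral_univ, h1]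
    simp only [Pi.mul_apply, one_mul, ENNReal.one_rpow, hone] at this
    have h3 := ENNReal.rpow_le_rpow this (zero_le_two : (0 : ℝ) ≤ 2)
    rw [← ENNReal.rpow_mul] at h3
    norm_num at h3
    rw [hμ, lintegral_withDensity_eq_lintegral_mul₀ (hkx x).aemeasurable hg,
      lintegral_withDensity_eq_lintegral_mul₀ (hkx x).aemeasurable (hg.pow_const 2)] at h3
    simpa using h3
  calc ∫⁻ x, (∫⁻ y, k (x - y) * g y) ^ (2 : ℝ)
      ≤ ∫⁻ x, ∫⁻ y, k (x - y) * g y ^ (2 : ℝ) := lintegral_mono h2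
    _ = ∫⁻ y, ∫⁻ x, k (x - y) * g y ^ (2 : ℝ) := by
        refine lintegral_lintegral_swap ?_
        exact (hk.comp (measurable_fst.sub measurable_snd)).aemeasurable.mul
          ((hg.pow_const _).comp_quasiMeasurePreserving Measure.quasiMeasurePreserving_snd)
    _ = ∫⁻ y, g y ^ (2 : ℝ) := by
        refine lintegral_congr fun y => ?_
        rw [lintegral_mul_const _ (show Measurable fun x => k (x - y) from
          hk.comp (measurable_id.sub measurable_const)),
          lintegral_sub_right_eq_self (μ := volume) k y, hk1, one_mul]

/-- Young's inequality `‖ρ ⋆ f‖_{L²} ≤ ‖f‖_{L²}`, for functions dominated by a mollification. -/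
theorem eLpNorm_le_of_norm_le_mollification {F G : Type*} [NormedAddCommGroup F]
    [NormedAddCommGroup G] (ρ : ContDiffBump (0 : E3)) {f : E3 → F} {g : E3 → G}
    (hf : AEStronglyMeasurable f volume)
    (hg : ∀ x, ‖g x‖ ≤ ∫ y, ρ.normed volume (x - y) * ‖f y‖) :
    eLpNorm g 2 volume ≤ eLpNorm f 2 volume := by
  have hk : Measurable fun x => ENNReal.ofReal (ρ.normed volume x) :=
    (ρ.continuous_normed.measurable).ennreal_ofReal
  have hk1 : ∫⁻ x, ENNReal.ofReal (ρ.normed volume x) = 1 := by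
    rw [← ofReal_integral_eq_lintegral_ofReal ρ.integrable_normed
      (Eventually.of_forall fun x => ρ.nonneg_normed x), ρ.integral_normed, ENNReal.ofReal_one]
  have key := lintegral_convolution_rpow_two_le hk hf.enorm hk1
  have hgx (x : E3) : ‖g x‖ₑ ≤ ∫⁻ y, ENNReal.ofReal (ρ.normed volume (x - y)) * ‖f y‖ₑ := by
    rw [← ofReal_norm]
    refine (ENNReal.ofReal_le_ofReal (hg x)).trans ?_
    refine (ENNReal.ofReal_le_ofReal (le_abs_self _)).trans ?_
    rw [← Real.norm_eq_abs, ofReal_norm]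
    refine (enorm_integral_le_lintegral_enorm _).trans (le_of_eq ?_)
    refine lintegral_congr fun y => ?_
    rw [enorm_mul, enorm_norm, Real.enorm_of_nonneg (ρ.nonneg_normed _)]
  rw [eLpNorm_eq_lintegral_rpow_enorm_toReal two_ne_zero ENNReal.ofNat_ne_top,
    eLpNorm_eq_lintegral_rpow_enorm_toReal two_ne_zero ENNReal.ofNat_ne_top]
  refine ENNReal.rpow_le_rpow ?_ (by simp)
  refine le_trans (lintegral_mono fun x => ?_) key
  exact ENNReal.rpow_le_rpow (hgx x) (by simp)

theorem locallyIntegrable_h1 (φ : H1) : LocallyIntegrable φ volume :=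
  (Lp.memLp φ.1.fst).locallyIntegrable one_le_two

/-- The mollification of `φ` by the normalised bump function `ρ`. -/
noncomputable def mollify (ρ : ContDiffBump (0 : E3)) (φ : H1) : E3 → ℝ :=
  convolution (ρ.normed volume) φ (ContinuousLinearMap.lsmul ℝ ℝ) volume

theorem mollify_eq (ρ : ContDiffBump (0 : E3)) (φ : H1) (x : E3) :
    mollify ρ φ x = ∫ y, ρ.normed volume (x - y) * φ y := by
  rw [mollify, convolution_eq_swap]
  simp

theorem contDiff_mollify (ρ : ContDiffBump (0 : E3)) (φ : H1) : ContDiff ℝ 1 (mollify ρ φ) :=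
  ρ.hasCompactSupport_normed.contDiff_convolution_left (n := 1) _ ρ.contDiff_normed
    (locallyIntegrable_h1 φ)

theorem eLpNorm_mollify_le (ρ : ContDiffBump (0 : E3)) (φ : H1) :
    eLpNorm (mollify ρ φ) 2 volume ≤ eLpNorm φ 2 volume := by
  refine eLpNorm_le_of_norm_le_mollification ρ (Lp.aestronglyMeasurable _) fun x => ?_
  rw [mollify_eq]
  refine (norm_integral_le_integral_norm _).trans (le_of_eq ?_)
  refine integral_congr_ae (Eventually.of_forall fun y => ?_)
  simp only [norm_mul, Real.norm_of_nonneg (ρ.nonneg_normed _)]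

/-- The derivative of the mollification is the mollification of the weak gradient. -/
theorem fderiv_mollify_single (ρ : ContDiffBump (0 : E3)) (φ : H1) (x : E3) (k : Fin 3) :
    fderiv ℝ (mollify ρ φ) x (EuclideanSpace.single k 1)
      = ∫ y, grad φ y k * ρ.normed volume (x - y) := by
  set r : E3 → ℝ := ρ.normed volume with hr
  have hr1 : ContDiff ℝ 1 r := ρ.contDiff_normed (n := 1)
  have hrinf : ContDiff ℝ ∞ r := ρ.contDiff_normed (n := ⊤)
  have hd := ρ.hasCompactSupport_normed.hasFDerivAt_convolution_left (μ := volume)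
    (ContinuousLinearMap.lsmul ℝ ℝ) hr1 (locallyIntegrable_h1 φ) x
  have hex := (ρ.hasCompactSupport_normed (μ := volume).fderiv ℝ).convolutionExists_left
    (μ := volume) ((ContinuousLinearMap.lsmul ℝ ℝ : ℝ →L[ℝ] ℝ →L[ℝ] ℝ).precompL E3)
    (hr1.continuous_fderiv one_ne_zero) (locallyIntegrable_h1 φ) x
  have hD : fderiv ℝ (mollify ρ φ) x (EuclideanSpace.single k 1)
      = ∫ y, fderiv ℝ r (x - y) (EuclideanSpace.single k 1) * φ y := by
    rw [mollify, hd.fderiv, convolution_eq_swap,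
      ContinuousLinearMap.integral_apply hex.integrable_swap]
    rfl
  have hf : ContDiff ℝ ∞ fun y => r (x - y) := hrinf.comp (contDiff_const.sub contDiff_id)
  have hfc : HasCompactSupport fun y => r (x - y) :=
    ρ.hasCompactSupport_normed.comp_homeomorph (Homeomorph.subLeft x)
  have hfd (y : E3) : fderiv ℝ (fun y => r (x - y)) y (EuclideanSpace.single k 1)
      = - fderiv ℝ r (x - y) (EuclideanSpace.single k 1) := by
    have h := ((hr1.differentiable one_ne_zero).differentiableAt (x := x - y)).hasFDerivAt.comp y
      ((hasFDerivAt_const x y).sub (hasFDerivAt_id y))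
    have h' : fderiv ℝ (fun y => r (x - y)) y = _ := h.fderiv
    rw [h']
    simp
  have hw := φ.2 (fun y => r (x - y)) hf hfc k
  simp only [hfd, mul_neg, integral_neg, neg_inj] at hw
  rw [hD]
  simpa only [mul_comm, grad] using hw

/-- The operator norm is at most the sum of the three partial derivatives, whence the constant `3`. -/
theorem norm_fderiv_mollify_le (ρ : ContDiffBump (0 : E3)) (φ : H1) (x : E3) :
    ‖fderiv ℝ (mollify ρ φ) x‖ ≤ 3 * ∫ y, ρ.normed volume (x - y) * ‖grad φ y‖ := by
  set I := ∫ y, ρ.normed volume (x - y) * ‖grad φ y‖ with hI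
  have hIint : Integrable (fun y => ρ.normed volume (x - y) * ‖grad φ y‖) volume := by
    have h1 : LocallyIntegrable (fun y => ‖grad φ y‖) volume :=
      (Lp.memLp φ.1.snd).norm.locallyIntegrable one_le_two
    have := (ρ.hasCompactSupport_normed (μ := volume)).convolutionExists_left (μ := volume)
      (ContinuousLinearMap.lsmul ℝ ℝ) ρ.continuous_normed h1 x
    simpa using this.integrable_swap
  have hk (k : Fin 3) : |fderiv ℝ (mollify ρ φ) x (EuclideanSpace.single k 1)| ≤ I := by
    rw [fderiv_mollify_single, ← Real.norm_eq_abs]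
    refine norm_integral_le_of_norm_le hIint (Eventually.of_forall fun y => ?_)
    rw [norm_mul, mul_comm, Real.norm_of_nonneg (ρ.nonneg_normed _)]
    exact mul_le_mul_of_nonneg_left (PiLp.norm_apply_le _ k) (ρ.nonneg_normed _)
  have hI0 : 0 ≤ I := (abs_nonneg _).trans (hk 0)
  refine ContinuousLinearMap.opNorm_le_bound _ (by positivity) fun v => ?_
  have hv : v = ∑ k, v k • EuclideanSpace.single k (1 : ℝ) := by
    ext j; simp [Finset.sum_apply, Pi.single_apply]
  conv_lhs => rw [hv, map_sum]
  refine (norm_sum_le _ _).trans ?_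
  have : ∀ k ∈ Finset.univ, ‖fderiv ℝ (mollify ρ φ) x (v k • EuclideanSpace.single k 1)‖
      ≤ ‖v‖ * I := fun k _ => by
    rw [map_smul, norm_smul]
    exact mul_le_mul (PiLp.norm_apply_le _ k) (hk k) (norm_nonneg _) (norm_nonneg _)
  refine (Finset.sum_le_sum this).trans (le_of_eq ?_)
  simp; ring

theorem eLpNorm_fderiv_mollify_le (ρ : ContDiffBump (0 : E3)) (φ : H1) :
    eLpNorm (fderiv ℝ (mollify ρ φ)) 2 volume ≤ 3 * eLpNorm (grad φ) 2 volume := by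
  have h := eLpNorm_le_of_norm_le_mollification
    (g := fun x => 1 / 3 * ‖fderiv ℝ (mollify ρ φ) x‖) ρ (Lp.aestronglyMeasurable φ.1.snd) fun x => by
      have := norm_fderiv_mollify_le ρ φ x
      rw [norm_mul, norm_norm]
      norm_num
      simp only [grad] at this
      linarith
  have h3 := eLpNorm_le_nnreal_smul_eLpNorm_of_ae_le_mul (μ := (volume : Measure E3)) (c := 3)
    (f := fderiv ℝ (mollify ρ φ)) (g := fun x => 1 / 3 * ‖fderiv ℝ (mollify ρ φ) x‖)
    (Eventually.of_forall fun x => by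
      rw [← NNReal.coe_le_coe]; simp) 2
  refine h3.trans ?_
  rw [ENNReal.smul_def, smul_eq_mul]
  exact mul_le_mul_right h _

theorem exists_norm_fderiv_bump_le (χ : ContDiffBump (0 : E3)) :
    ∃ K : ℝ, 0 ≤ K ∧ ∀ x, ‖fderiv ℝ χ x‖ ≤ K := by
  obtain ⟨K, hK⟩ := (χ.hasCompactSupport.fderiv ℝ).exists_bound_of_continuous
    (χ.contDiff (n := 1).continuous_fderiv one_ne_zero)
  exact ⟨K, (norm_nonneg _).trans (hK 0), hK⟩

theorem eLpNorm_le_enorm (φ : H1) : eLpNorm φ 2 volume ≤ ‖φ‖ₑ := by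
  rw [← Lp.enorm_def, ← ofReal_norm, ← ofReal_norm]
  exact ENNReal.ofReal_le_ofReal (WithLp.norm_fst_le _ φ.1)

theorem eLpNorm_grad_le_enorm (φ : H1) : eLpNorm (grad φ) 2 volume ≤ ‖φ‖ₑ := by
  rw [grad, ← Lp.enorm_def, ← ofReal_norm, ← ofReal_norm]
  exact ENNReal.ofReal_le_ofReal (WithLp.norm_snd_le _ φ.1)

/-- Cutting off at scale `1/c ≥ 1` costs a zeroth order term with a constant independent of `c`. -/
theorem norm_fderiv_cutoff_mul_le (χ : ContDiffBump (0 : E3)) {K c : ℝ}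
    (hK : ∀ x, ‖fderiv ℝ χ x‖ ≤ K) (hc0 : 0 ≤ c) (hc1 : c ≤ 1) {u : E3 → ℝ} {x : E3}
    (hu : DifferentiableAt ℝ u x) :
    ‖fderiv ℝ (fun x => χ (c • x) * u x) x‖ ≤ ‖fderiv ℝ u x‖ + K * ‖u x‖ := by
  have hχd : HasFDerivAt (fun x => χ (c • x)) (c • fderiv ℝ χ (c • x)) x := by
    have h := ((χ.contDiff (n := 1)).differentiable one_ne_zero).differentiableAt
      (x := c • x) |>.hasFDerivAt.comp x ((hasFDerivAt_id x).const_smul c)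
    convert! h using 1
    ext v; simp
  rw [(hχd.fun_mul hu.hasFDerivAt).fderiv]
  refine (norm_add_le _ _).trans (add_le_add ?_ ?_)
  · rw [norm_smul, Real.norm_of_nonneg χ.nonneg]
    exact mul_le_of_le_one_left (norm_nonneg _) χ.le_one
  · rw [norm_smul, norm_smul, Real.norm_of_nonneg hc0, mul_comm K]
    refine mul_le_mul_of_nonneg_left ?_ (norm_nonneg _)
    exact (mul_le_of_le_one_left (norm_nonneg _) hc1).trans (hK _)

theorem eLpNorm_fderiv_cutoff_mollify_le (χ ρ : ContDiffBump (0 : E3)) {K c : ℝ} (hK0 : 0 ≤ K)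
    (hK : ∀ x, ‖fderiv ℝ χ x‖ ≤ K) (hc0 : 0 ≤ c) (hc1 : c ≤ 1) (φ : H1) :
    eLpNorm (fderiv ℝ fun x => χ (c • x) * mollify ρ φ x) 2 volume
      ≤ (3 + K.toNNReal : NNReal) * ‖φ‖ₑ := by
  have hu : ContDiff ℝ 1 (mollify ρ φ) := contDiff_mollify ρ φ
  calc eLpNorm (fderiv ℝ fun x => χ (c • x) * mollify ρ φ x) 2 volume
      ≤ eLpNorm (fun x => ‖fderiv ℝ (mollify ρ φ) x‖ + K * ‖mollify ρ φ x‖) 2 volume :=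
        eLpNorm_mono_real fun x => norm_fderiv_cutoff_mul_le χ hK hc0 hc1
          (hu.differentiable one_ne_zero).differentiableAt
    _ ≤ eLpNorm (fun x => ‖fderiv ℝ (mollify ρ φ) x‖) 2 volume
        + eLpNorm (fun x => K * ‖mollify ρ φ x‖) 2 volume := by
        refine eLpNorm_add_le ?_ ?_ one_le_two
        · exact (hu.continuous_fderiv one_ne_zero).norm.aestronglyMeasurable
        · exact (continuous_const.mul hu.continuous.norm).aestronglyMeasurable
    _ ≤ 3 * ‖φ‖ₑ + K.toNNReal * ‖φ‖ₑ := by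
        refine add_le_add ?_ ?_
        · rw [eLpNorm_norm]
          exact (eLpNorm_fderiv_mollify_le _ _).trans (mul_le_mul_right (eLpNorm_grad_le_enorm φ) _)
        · have h : eLpNorm (fun x => K * ‖mollify ρ φ x‖) 2 volume
              = ‖K‖ₑ * eLpNorm (fun x => ‖mollify ρ φ x‖) 2 volume :=
            eLpNorm_const_smul (μ := volume) (p := 2) K (fun x => ‖mollify ρ φ x‖)
          rw [h, eLpNorm_norm, Real.enorm_of_nonneg hK0]
          exact mul_le_mul_right ((eLpNorm_mollify_le _ _).trans (eLpNorm_le_enorm φ)) _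
    _ = (3 + K.toNNReal : NNReal) * ‖φ‖ₑ := by push_cast; ring

theorem contDiff_cutoff_mollify (χ ρ : ContDiffBump (0 : E3)) (c : ℝ) (φ : H1) :
    ContDiff ℝ 1 fun x => χ (c • x) * mollify ρ φ x := by
  have h1 : ContDiff ℝ 1 fun x : E3 => c • x := contDiff_id.const_smul c
  have h2 : ContDiff ℝ 1 fun x : E3 => χ (c • x) := (χ.contDiff (n := 1)).comp h1
  exact h2.mul (contDiff_mollify ρ φ)

theorem eLpNorm_six_cutoff_mollify_le (χ ρ : ContDiffBump (0 : E3)) {K c : ℝ} (hK0 : 0 ≤ K)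
    (hK : ∀ x, ‖fderiv ℝ χ x‖ ≤ K) (hc0 : 0 < c) (hc1 : c ≤ 1) (φ : H1) :
    eLpNorm (fun x => χ (c • x) * mollify ρ φ x) 6 volume
      ≤ SNormLESNormFDerivOfEqConst ℝ (volume : Measure E3) 2
        * ((3 + K.toNNReal : NNReal) * ‖φ‖ₑ) := by
  have hwc : HasCompactSupport fun x => χ (c • x) * mollify ρ φ x := by
    have : HasCompactSupport fun x : E3 => χ (c • x) :=
      χ.hasCompactSupport.comp_homeomorph (Homeomorph.smulOfNeZero c hc0.ne')
    exact this.mul_right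
  have hGNS := eLpNorm_le_eLpNorm_fderiv_of_eq (volume : Measure E3)
    (contDiff_cutoff_mollify χ ρ c φ) hwc (p := 2) (p' := 6) one_le_two (by simp)
    (by simp; norm_num)
  refine le_trans (by exact_mod_cast hGNS) (mul_le_mul_right ?_ _)
  exact eLpNorm_fderiv_cutoff_mollify_le χ ρ hK0 hK hc0.le hc1 φ

theorem exists_bump_seq : ∃ ρ : ℕ → ContDiffBump (0 : E3),
    Tendsto (fun n => (ρ n).rOut) atTop (𝓝 0) ∧ ∀ n, (ρ n).rOut ≤ 2 * (ρ n).rIn := by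
  refine ⟨fun n => ⟨1 / ((n : ℝ) + 1), 2 * (1 / ((n : ℝ) + 1)), Nat.one_div_pos_of_nat, ?_⟩,
    ?_, fun n => le_rfl⟩
  · have := Nat.one_div_pos_of_nat (α := ℝ) (n := n)
    linarith
  · simpa using (tendsto_one_div_add_atTop_nhds_zero_nat (𝕜 := ℝ)).const_mul 2

theorem tendsto_cutoff_mollify {χ : ContDiffBump (0 : E3)} {ρ : ℕ → ContDiffBump (0 : E3)}
    {c : ℕ → ℝ} (hρ : Tendsto (fun n => (ρ n).rOut) atTop (𝓝 0))
    (hρ2 : ∀ n, (ρ n).rOut ≤ 2 * (ρ n).rIn) (hc : Tendsto c atTop (𝓝 0)) (φ : H1) :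
    ∀ᵐ x ∂(volume : Measure E3),
      Tendsto (fun n => χ (c n • x) * mollify (ρ n) φ x) atTop (𝓝 (φ x)) := by
  have h := ContDiffBump.ae_convolution_tendsto_right_of_locallyIntegrable (μ := volume)
    (φ := ρ) (l := atTop) (K := 2) hρ (Eventually.of_forall hρ2) (locallyIntegrable_h1 φ)
  filter_upwards [h] with x hx
  refine Tendsto.congr' ?_ hx
  have hcx : Tendsto (fun n => c n • x) atTop (𝓝 0) := by
    simpa using hc.smul_const x
  filter_upwards [hcx.eventually (Metric.closedBall_mem_nhds (0 : E3) χ.rIn_pos)] with n hn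
  rw [χ.one_of_mem_closedBall hn, one_mul]
  rfl

/-- The Sobolev inequality `‖φ‖_{L⁶} ≤ C ‖φ‖_{H¹}`: apply the Gagliardo-Nirenberg-Sobolev inequality
to truncated mollifications of `φ` and conclude with Fatou's lemma. -/
theorem exists_eLpNorm_six_le : ∃ C : NNReal, ∀ φ : H1, eLpNorm φ 6 volume ≤ C * ‖φ‖ₑ := by
  obtain ⟨χ⟩ : Nonempty (ContDiffBump (0 : E3)) := inferInstance
  obtain ⟨K, hK0, hK⟩ := exists_norm_fderiv_bump_le χ
  obtain ⟨ρ, hρ, hρ2⟩ := exists_bump_seq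
  refine ⟨SNormLESNormFDerivOfEqConst ℝ (volume : Measure E3) 2 * (3 + K.toNNReal),
    fun φ => ?_⟩
  have hc1 (n : ℕ) : 1 / ((n : ℝ) + 1) ≤ 1 := by
    rw [div_le_one (by positivity)]; linarith [n.cast_nonneg (α := ℝ)]
  rw [ENNReal.coe_mul, mul_assoc]
  exact Lp.eLpNorm_le_of_ae_tendsto (Eventually.of_forall fun n =>
      eLpNorm_six_cutoff_mollify_le χ (ρ n) hK0 hK Nat.one_div_pos_of_nat (hc1 n) φ)
    (fun n => (contDiff_cutoff_mollify χ (ρ n) _ φ).continuous.aestronglyMeasurable)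
    (tendsto_cutoff_mollify hρ hρ2 tendsto_one_div_add_atTop_nhds_zero_nat φ)

/-! ### Products of `H¹` functions and the Coulomb kernel -/

instance holderTriple_six_six_three : ENNReal.HolderTriple 6 6 3 where
  inv_add_inv_eq_inv := by
    rw [← two_mul, show (6 : ℝ≥0∞) = 2 * 3 by norm_num,
      ENNReal.mul_inv (Or.inl two_ne_zero) (Or.inl ENNReal.ofNat_ne_top), ← mul_assoc,
      ENNReal.mul_inv_cancel two_ne_zero ENNReal.ofNat_ne_top, one_mul]

instance holderTriple_three_halves : ENNReal.HolderTriple (3 / 2) 3 1 where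
  inv_add_inv_eq_inv := by
    rw [ENNReal.inv_div (Or.inl ENNReal.ofNat_ne_top) (Or.inl two_ne_zero), ← one_div,
      ENNReal.div_add_div_same, inv_one]
    norm_num
    exact ENNReal.div_self (by norm_num) ENNReal.ofNat_ne_top

theorem memLp_six (φ : H1) : MemLp φ 6 volume := by
  obtain ⟨C, hC⟩ := exists_eLpNorm_six_le
  exact ⟨Lp.aestronglyMeasurable _,
    (hC φ).trans_lt (ENNReal.mul_lt_top ENNReal.coe_lt_top enorm_lt_top)⟩

theorem memLp_two (φ : H1) : MemLp φ 2 volume := Lp.memLp _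

theorem memLp_one_mul (φ η : H1) : MemLp (fun x => φ x * η x) 1 volume :=
  (memLp_two η).mul' (memLp_two φ)

theorem memLp_three_mul (φ η : H1) : MemLp (fun x => φ x * η x) 3 volume :=
  (memLp_six η).mul' (memLp_six φ)

/-- Hölder's inequality for products of real functions. -/
theorem eLpNorm_mul_le {f g : E3 → ℝ} (p q r : ℝ≥0∞) [ENNReal.HolderTriple p q r]
    (hf : AEStronglyMeasurable f volume) (hg : AEStronglyMeasurable g volume) :
    eLpNorm (fun x => f x * g x) r volume ≤ eLpNorm f p volume * eLpNorm g q volume := by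
  have h := eLpNorm_smul_le_mul_eLpNorm (p := p) (q := q) (r := r) hg hf
  exact h

/-- The product map `H¹ × H¹ → L¹ ∩ L³` is bounded, as `H¹ ⊂ L² ∩ L⁶`. -/
theorem exists_normL1L3_mul_le :
    ∃ C : ℝ, 0 ≤ C ∧ ∀ φ η : H1, normL1L3 (fun x => φ x * η x) ≤ C * ‖φ‖ * ‖η‖ := by
  obtain ⟨C, hC⟩ := exists_eLpNorm_six_le
  refine ⟨1 + C ^ 2, by positivity, fun φ η => ?_⟩
  have h1 : eLpNorm (fun x => φ x * η x) 1 volume ≤ ‖φ‖ₑ * ‖η‖ₑ :=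
    (eLpNorm_mul_le 2 2 1 (memLp_two φ).1 (memLp_two η).1).trans
      (mul_le_mul' (eLpNorm_le_enorm φ) (eLpNorm_le_enorm η))
  have h3 : eLpNorm (fun x => φ x * η x) 3 volume ≤ C * ‖φ‖ₑ * (C * ‖η‖ₑ) :=
    (eLpNorm_mul_le 6 6 3 (memLp_six φ).1 (memLp_six η).1).trans
      (mul_le_mul' (hC φ) (hC η))
  have h1' := ENNReal.toReal_mono (by finiteness) h1
  have h3' := ENNReal.toReal_mono (by finiteness) h3
  simp only [ENNReal.toReal_mul, toReal_enorm, ENNReal.coe_toReal] at h1' h3'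
  rw [normL1L3]
  linarith

/-- The Hölder pairing of `L^∞ + L^{3/2}` with `L¹ ∩ L³`. -/
theorem integrable_mul_and_integral_norm_le {v₁ v₂ h : E3 → ℝ} (hv₁ : MemLp v₁ ∞ volume)
    (hv₂ : MemLp v₂ (3 / 2) volume) (h1 : MemLp h 1 volume) (h3 : MemLp h 3 volume) :
    Integrable (fun x => (v₁ x + v₂ x) * h x) volume ∧
      ∫ x, ‖(v₁ x + v₂ x) * h x‖ ≤ ((eLpNorm v₁ ∞ volume).toReal
        + (eLpNorm v₂ (3 / 2) volume).toReal) * normL1L3 h := by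
  have i1 : MemLp (fun x => v₁ x * h x) 1 volume := h1.mul' hv₁
  have i2 : MemLp (fun x => v₂ x * h x) 1 volume := h3.mul' hv₂
  have e1 : eLpNorm (fun x => v₁ x * h x) 1 volume ≤ eLpNorm v₁ ∞ volume * eLpNorm h 1 volume :=
    eLpNorm_mul_le ∞ 1 1 hv₁.1 h1.1
  have e2 : eLpNorm (fun x => v₂ x * h x) 1 volume
      ≤ eLpNorm v₂ (3 / 2) volume * eLpNorm h 3 volume :=
    eLpNorm_mul_le (3 / 2) 3 1 hv₂.1 h3.1
  have e : eLpNorm (fun x => (v₁ x + v₂ x) * h x) 1 volume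
      ≤ eLpNorm v₁ ∞ volume * eLpNorm h 1 volume
        + eLpNorm v₂ (3 / 2) volume * eLpNorm h 3 volume := by
    simp only [add_mul]
    exact (eLpNorm_add_le i1.1 i2.1 le_rfl).trans (add_le_add e1 e2)
  have i : MemLp (fun x => (v₁ x + v₂ x) * h x) 1 volume := by
    simp only [add_mul]
    exact i1.add i2
  refine ⟨memLp_one_iff_integrable.1 i, ?_⟩
  have hfin1 := ENNReal.mul_ne_top hv₁.2.ne h1.2.ne
  have hfin2 := ENNReal.mul_ne_top hv₂.2.ne h3.2.ne
  rw [integral_norm_eq_lintegral_enorm i.1, ← eLpNorm_one_eq_lintegral_enorm]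
  refine (ENNReal.toReal_mono (ENNReal.add_ne_top.2 ⟨hfin1, hfin2⟩) e).trans ?_
  rw [ENNReal.toReal_add hfin1 hfin2, ENNReal.toReal_mul, ENNReal.toReal_mul, normL1L3]
  have ha : 0 ≤ (eLpNorm v₁ ∞ volume).toReal := ENNReal.toReal_nonneg
  have hb : 0 ≤ (eLpNorm v₂ (3 / 2) volume).toReal := ENNReal.toReal_nonneg
  have hc : 0 ≤ (eLpNorm h 1 volume).toReal := ENNReal.toReal_nonneg
  have hd : 0 ≤ (eLpNorm h 3 volume).toReal := ENNReal.toReal_nonneg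
  generalize (eLpNorm v₁ ∞ volume).toReal = a at ha ⊢
  generalize (eLpNorm v₂ (3 / 2) volume).toReal = b at hb ⊢
  generalize (eLpNorm h 1 volume).toReal = c at hc ⊢
  generalize (eLpNorm h 3 volume).toReal = d at hd ⊢
  have := mul_nonneg ha hd
  have := mul_nonneg hb hc
  linarith [add_mul a b (c + d), mul_add a c d, mul_add b c d]

/-- In polar coordinates the integral is `∫₀¹ t² t^{-3/2} dt`, up to a constant. -/
theorem memLp_inv_norm_ball :
    MemLp ((Metric.ball (0 : E3) 1).indicator fun x => ‖x‖⁻¹) (3 / 2) volume := by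
  have hmeas : Measurable fun x : E3 => ‖x‖⁻¹ := measurable_norm.inv
  rw [memLp_indicator_iff_restrict measurableSet_ball,
    ← integrable_norm_rpow_iff hmeas.aestronglyMeasurable (by simp)
      (ENNReal.div_ne_top ENNReal.ofNat_ne_top two_ne_zero)]
  have h := (integrableOn_fun_norm_addHaar (volume : Measure E3) (r := 1)
    (f := fun t => ‖t⁻¹‖ ^ (3 / 2 : ℝ≥0∞).toReal)).2 ?_
  · refine h.congr (Eventually.of_forall fun x => ?_)
    simp
  · have h2 : IntegrableOn (fun t : ℝ => t ^ (1 / 2 : ℝ)) (Ioo 0 1) volume :=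
      (intervalIntegral.integrableOn_Ioo_rpow_iff one_pos).2 (by norm_num)
    refine h2.congr_fun (fun t ht => ?_) measurableSet_Ioo
    have ht0 : 0 < t := ht.1
    simp only [finrank_euclideanSpace, Fintype.card_fin, smul_eq_mul, ENNReal.toReal_div,
      ENNReal.toReal_ofNat]
    rw [norm_inv, Real.norm_of_nonneg ht0.le, Real.inv_rpow ht0.le, ← Real.rpow_neg ht0.le,
      ← Real.rpow_natCast, ← Real.rpow_add ht0]
    norm_num

theorem memLp_inv_norm_compl_ball :
    MemLp ((Metric.ball (0 : E3) 1)ᶜ.indicator fun x => ‖x‖⁻¹) ∞ volume := by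
  have hmeas : Measurable fun x : E3 => ‖x‖⁻¹ := measurable_norm.inv
  refine memLp_top_of_bound
    (hmeas.indicator measurableSet_ball.compl).aestronglyMeasurable 1
    (Eventually.of_forall fun x => ?_)
  by_cases hx : x ∈ (Metric.ball (0 : E3) 1)ᶜ
  · rw [indicator_of_mem hx, norm_inv, norm_norm]
    exact inv_le_one_of_one_le₀ (by simpa using hx)
  · rw [indicator_of_notMem hx]
    simp

/-- The Coulomb potential of an element of `L¹ ∩ L³` exists and is bounded. The kernel is split at the
unit sphere into parts in `L^∞` and `L^{3/2}`, whose norms do not depend on the point `x`. -/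
theorem exists_coulomb_bound : ∃ C : ℝ, 0 ≤ C ∧ ∀ (h : E3 → ℝ) (x : E3), MemLp h 1 volume →
    MemLp h 3 volume → Integrable (fun y => h y / ‖x - y‖) volume ∧
      ∫ y, ‖h y / ‖x - y‖‖ ≤ C * normL1L3 h := by
  refine ⟨(eLpNorm ((Metric.ball (0 : E3) 1)ᶜ.indicator fun x => ‖x‖⁻¹) ∞ volume).toReal
    + (eLpNorm ((Metric.ball (0 : E3) 1).indicator fun x => ‖x‖⁻¹) (3 / 2) volume).toReal,
    by positivity, fun h x h1 h3 => ?_⟩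
  have hmp := Measure.measurePreserving_sub_left (volume : Measure E3) x
  have key := integrable_mul_and_integral_norm_le
    (memLp_inv_norm_compl_ball.comp_measurePreserving hmp)
    (memLp_inv_norm_ball.comp_measurePreserving hmp) h1 h3
  rw [eLpNorm_comp_measurePreserving memLp_inv_norm_compl_ball.1 hmp,
    eLpNorm_comp_measurePreserving memLp_inv_norm_ball.1 hmp] at key
  have hsum : (fun y => h y / ‖x - y‖) = fun y =>
      ((((Metric.ball (0 : E3) 1)ᶜ.indicator fun x => ‖x‖⁻¹) ∘ fun y => x - y) y
        + (((Metric.ball (0 : E3) 1).indicator fun x => ‖x‖⁻¹) ∘ fun y => x - y) y) * h y := by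
    ext y
    simp only [Function.comp_apply]
    rw [← Pi.add_apply (Set.indicator _ _), indicator_compl_add_self, div_eq_inv_mul]
  have hsum' (y : E3) := congrFun hsum y
  refine ⟨by rw [hsum]; exact key.1, ?_⟩
  simp only [hsum']
  exact key.2

/-! ### Calculus of bounded multilinear forms -/

section Multilinear

variable {E : Type*} [NormedAddCommGroup E] [NormedSpace ℝ E]

/-- A symmetric map, linear in its first argument and bounded, is a bounded bilinear form. -/
theorem exists_symm_bilin {G : Type*} [NormedAddCommGroup G] [NormedSpace ℝ G]
    (f : E → E → G) (hadd : ∀ a b c, f (a + b) c = f a c + f b c)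
    (hsmul : ∀ (r : ℝ) a c, f (r • a) c = r • f a c) (hsymm : ∀ a b, f a b = f b a)
    (C : ℝ) (hC : ∀ a b, ‖f a b‖ ≤ C * ‖a‖ * ‖b‖) :
    ∃ B : E →L[ℝ] E →L[ℝ] G, ∀ a b, B a b = f a b :=
  ⟨LinearMap.mkContinuous₂ (LinearMap.mk₂ ℝ f hadd hsmul
      (fun a b c => by rw [hsymm, hadd, hsymm b, hsymm c])
      (fun r a c => by rw [hsymm, hsmul, hsymm c])) C hC, fun _ _ => rfl⟩

theorem sum_smul_bilin_apply {ι : Type*} [Fintype ι] (c : ι → ℝ) (B : ι → E →L[ℝ] E →L[ℝ] ℝ)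
    (φ η : E) : (∑ i, c i • B i) φ η = ∑ i, c i * B i φ η := by
  simp

theorem add_bilin_apply (A W : E →L[ℝ] E →L[ℝ] ℝ) (φ η : E) : (A + W) φ η = A φ η + W φ η := rfl

theorem sub_zero_mul (a b : ℝ) : a - 0 * b = a := by ring

/-- `f` is a bounded quadrilinear form. -/
def IsBoundedQuadrilinear (f : E → E → E → E → ℝ) : Prop :=
  ∃ D : E →L[ℝ] E →L[ℝ] E →L[ℝ] E →L[ℝ] ℝ, ∀ c d a b, D c d a b = f c d a b

theorem isBoundedQuadrilinear_of_bound {f : E → E → E → E → ℝ}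
    (hB : ∀ c d, ∃ B : E →L[ℝ] E →L[ℝ] ℝ, ∀ a b, B a b = f c d a b)
    (hadd : ∀ c c' d a b, f (c + c') d a b = f c d a b + f c' d a b)
    (hsmul : ∀ (r : ℝ) c d a b, f (r • c) d a b = r * f c d a b)
    (hsymm : ∀ c d a b, f c d a b = f d c a b) {C : ℝ} (hC0 : 0 ≤ C)
    (hC : ∀ c d a b, ‖f c d a b‖ ≤ C * ‖c‖ * ‖d‖ * ‖a‖ * ‖b‖) :
    IsBoundedQuadrilinear f := by
  choose W hW using hB
  obtain ⟨D, hD⟩ := exists_symm_bilin W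
    (fun c c' d => by ext a b; simp [hW, hadd]) (fun r c d => by ext a b; simp [hW, hsmul])
    (fun c d => by ext a b; rw [hW, hW, hsymm]) C
    (fun c d => ContinuousLinearMap.opNorm_le_bound₂ _ (by positivity) fun a b => by
      rw [hW]; exact hC c d a b)
  exact ⟨D, fun c d a b => by rw [hD, hW]⟩

/-- `J` is Fréchet differentiable at `Φ` with `J'(Φ) = 𝓐 Φ`, i.e. `DJ(Φ)[h] = 2 ∑ᵢ ⟨A φᵢ, hᵢ⟩`. -/
def HasGradientAt {N : ℕ} (J : (Fin N → E) → ℝ) (A : E →L[ℝ] E →L[ℝ] ℝ) (Φ : Fin N → E) : Prop :=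
  HasFDerivAt J ((2 : ℝ) • ∑ i, (A (Φ i)).comp (ContinuousLinearMap.proj i)) Φ

variable {N : ℕ} {J J₁ J₂ : (Fin N → E) → ℝ} {A A₁ A₂ : E →L[ℝ] E →L[ℝ] ℝ} {Φ : Fin N → E}

theorem HasGradientAt.of_exists {L : (Fin N → E) →L[ℝ] ℝ} (h : HasFDerivAt J L Φ)
    (hL : ∀ η, L η = 2 * ∑ i, A (Φ i) (η i)) : HasGradientAt J A Φ := by
  have : L = (2 : ℝ) • ∑ i, (A (Φ i)).comp (ContinuousLinearMap.proj i) := by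
    ext η
    simp [hL]
  rwa [HasGradientAt, ← this]

theorem HasGradientAt.add (h₁ : HasGradientAt J₁ A₁ Φ) (h₂ : HasGradientAt J₂ A₂ Φ) :
    HasGradientAt (fun Φ => J₁ Φ + J₂ Φ) (A₁ + A₂) Φ :=
  .of_exists (HasFDerivAt.fun_add h₁ h₂) fun η => by
    simp [Finset.sum_add_distrib, mul_add]

theorem HasGradientAt.sub (h₁ : HasGradientAt J₁ A₁ Φ) (h₂ : HasGradientAt J₂ A₂ Φ) :
    HasGradientAt (fun Φ => J₁ Φ - J₂ Φ) (A₁ - A₂) Φ :=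
  .of_exists (HasFDerivAt.fun_sub h₁ h₂) fun η => by
    simp [Finset.sum_sub_distrib, mul_sub]

theorem HasGradientAt.const_mul (c : ℝ) (h : HasGradientAt J A Φ) :
    HasGradientAt (fun Φ => c * J Φ) (c • A) Φ :=
  .of_exists (HasFDerivAt.const_mul h c) fun η => by
    simp only [_root_.smul_apply, _root_.sum_apply, ContinuousLinearMap.comp_apply,
      ContinuousLinearMap.proj_apply, smul_eq_mul, ← Finset.mul_sum]
    ring

/-- Functionals that agree to first order at `Φ` have the same gradient there. -/
theorem HasGradientAt.congr_of_isLittleO (h₁ : HasGradientAt J₁ A Φ)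
    (ho : ∀ ε > 0, ∀ᶠ h in 𝓝 0, |J (Φ + h) - J Φ - (J₁ (Φ + h) - J₁ Φ)| ≤ ε * ‖h‖) :
    HasGradientAt J A Φ := by
  rw [HasGradientAt, hasFDerivAt_iff_isLittleO_nhds_zero] at h₁ ⊢
  have h : (fun h => J (Φ + h) - J Φ - (J₁ (Φ + h) - J₁ Φ)) =o[𝓝 0] fun h => h :=
    Asymptotics.isLittleO_iff.2 fun ε hε => ho ε hε
  refine (h.add h₁).congr_left fun h => ?_
  ring

theorem quadratic_add_sub {B : E →L[ℝ] E →L[ℝ] ℝ} (hB : ∀ φ η, B φ η = B η φ) (φ η : E) :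
    B ((2 : ℝ) • φ + η) η = B (φ + η) (φ + η) - B φ φ := by
  simp only [map_add, map_smul, _root_.add_apply, _root_.smul_apply, smul_eq_mul]
  rw [hB η φ]
  ring

theorem hasGradientAt_quadratic {B : E →L[ℝ] E →L[ℝ] ℝ} (hB : ∀ φ η, B φ η = B η φ)
    (Φ : Fin N → E) : HasGradientAt (fun Φ => ∑ i, B (Φ i) (Φ i)) B Φ := by
  have hp (i : Fin N) : HasFDerivAt (fun Φ : Fin N → E => Φ i) (ContinuousLinearMap.proj i) Φ :=
    (ContinuousLinearMap.proj (R := ℝ) (φ := fun _ : Fin N => E) i).hasFDerivAt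
  refine .of_exists (HasFDerivAt.fun_sum fun i _ =>
    (B.hasFDerivAt.comp Φ (hp i)).clm_apply (hp i)) fun η => ?_
  simp [Finset.mul_sum]
  refine Finset.sum_congr rfl fun i _ => ?_
  rw [hB (η i)]; ring

theorem exists_hasFDerivAt_quadrilinear {f : E → E → E → E → ℝ} (hf : IsBoundedQuadrilinear f)
    (Φ : Fin N → E) (i j k l : Fin N) : ∃ L : (Fin N → E) →L[ℝ] ℝ,
      HasFDerivAt (fun Φ : Fin N → E => f (Φ i) (Φ j) (Φ k) (Φ l)) L Φ ∧
      ∀ η, L η = f (η i) (Φ j) (Φ k) (Φ l) + f (Φ i) (η j) (Φ k) (Φ l)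
        + f (Φ i) (Φ j) (η k) (Φ l) + f (Φ i) (Φ j) (Φ k) (η l) := by
  obtain ⟨D, hD⟩ := hf
  have hp (i : Fin N) : HasFDerivAt (fun Φ : Fin N → E => Φ i) (ContinuousLinearMap.proj i) Φ :=
    (ContinuousLinearMap.proj (R := ℝ) (φ := fun _ : Fin N => E) i).hasFDerivAt
  simp only [← hD]
  refine ⟨_, (((D.hasFDerivAt.comp Φ (hp i)).clm_apply (hp j)).clm_apply (hp k)).clm_apply (hp l),
    fun η => ?_⟩
  simp
  ring

/-- The direct term: `½ ∑ᵢⱼ f(φⱼ, φⱼ, φᵢ, φᵢ)` has the gradient operator `∑ⱼ f(φⱼ, φⱼ, ·, ·)`. -/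
theorem hasGradientAt_direct {f : E → E → E → E → ℝ} (hf : IsBoundedQuadrilinear f)
    (h₁ : ∀ a b c d, f a b c d = f b a c d) (h₂ : ∀ a b c d, f a b c d = f c d a b)
    (hA : ∀ φ η, A φ η = ∑ j, f (Φ j) (Φ j) φ η) :
    HasGradientAt (fun Φ => 1 / 2 * ∑ i, ∑ j, f (Φ j) (Φ j) (Φ i) (Φ i)) A Φ := by
  choose L hL hL' using fun i j => exists_hasFDerivAt_quadrilinear hf Φ j j i i
  refine .of_exists ((HasFDerivAt.fun_sum fun i _ =>
    HasFDerivAt.fun_sum fun j _ => hL i j).const_mul (1 / 2)) fun η => ?_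
  have e (i j : Fin N) : L i j η
      = 2 * f (Φ i) (Φ i) (Φ j) (η j) + 2 * f (Φ j) (Φ j) (Φ i) (η i) := by
    rw [hL', h₁ (η j), h₂ (Φ j) (η j), h₂ (Φ j) (Φ j) (η i), h₁ (η i), h₂ (Φ i) (η i)]
    ring
  simp only [_root_.smul_apply, _root_.sum_apply, e, Finset.sum_add_distrib, smul_eq_mul, hA]
  rw [Finset.sum_comm (f := fun i j => 2 * f (Φ i) (Φ i) (Φ j) (η j))]
  simp only [← Finset.mul_sum]
  ring

/-- The exchange term: `½ ∑ᵢⱼ f(φⱼ, φᵢ, φᵢ, φⱼ)` has the gradient operator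
`(φ, η) ↦ ∑ⱼ f(φⱼ, φ, φⱼ, η)`. -/
theorem hasGradientAt_exchange {f : E → E → E → E → ℝ} (hf : IsBoundedQuadrilinear f)
    (h₁ : ∀ a b c d, f a b c d = f b a c d) (h₂ : ∀ a b c d, f a b c d = f c d a b)
    (hA : ∀ φ η, A φ η = ∑ j, f (Φ j) φ (Φ j) η) :
    HasGradientAt (fun Φ => 1 / 2 * ∑ i, ∑ j, f (Φ j) (Φ i) (Φ i) (Φ j)) A Φ := by
  have h₃ (a b c d : E) : f a b c d = f a b d c := by rw [h₂, h₁, h₂]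
  choose L hL hL' using fun i j => exists_hasFDerivAt_quadrilinear hf Φ j i i j
  refine .of_exists ((HasFDerivAt.fun_sum fun i _ =>
    HasFDerivAt.fun_sum fun j _ => hL i j).const_mul (1 / 2)) fun η => ?_
  have e (i j : Fin N) : L i j η
      = 2 * f (Φ i) (Φ j) (Φ i) (η j) + 2 * f (Φ j) (Φ i) (Φ j) (η i) := by
    rw [hL', h₂ (η j), h₃ (Φ i) (Φ j) (η j), h₂ (Φ j) (η i), h₁ (Φ i) (Φ j) (Φ j) (η i),
      h₃ (Φ j) (Φ i) (η i), h₁ (Φ j) (Φ i) (Φ i) (η j)]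
    ring
  simp only [_root_.smul_apply, _root_.sum_apply, e, Finset.sum_add_distrib, smul_eq_mul, hA]
  rw [Finset.sum_comm (f := fun i j => 2 * f (Φ i) (Φ j) (Φ i) (η j))]
  simp only [← Finset.mul_sum]
  ring

theorem exists_directOperator {f : E → E → E → E → ℝ} (hf : IsBoundedQuadrilinear f)
    (Φ : Fin N → E) :
    ∃ A : E →L[ℝ] E →L[ℝ] ℝ, ∀ φ η, A φ η = ∑ j, f (Φ j) (Φ j) φ η := by
  obtain ⟨D, hD⟩ := hf
  exact ⟨∑ j, D (Φ j) (Φ j), fun φ η => by simp [hD]⟩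

theorem exists_exchangeOperator {f : E → E → E → E → ℝ} (hf : IsBoundedQuadrilinear f)
    (Φ : Fin N → E) :
    ∃ A : E →L[ℝ] E →L[ℝ] ℝ, ∀ φ η, A φ η = ∑ j, f (Φ j) φ (Φ j) η := by
  obtain ⟨D, hD⟩ := hf
  exact ⟨∑ j, (D (Φ j)).flip (Φ j), fun φ η => by simp [hD]⟩

/-- `∑ⱼ B(φⱼ, φⱼ)` is invariant under orthogonal transformations of the tuple. -/
theorem sum_orthogonal {G : Type*} [AddCommGroup G] [Module ℝ G] (B : E →ₗ[ℝ] E →ₗ[ℝ] G)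
    (Ψ : Fin N → E) {U : Matrix (Fin N) (Fin N) ℝ} (hU : U ∈ Matrix.orthogonalGroup (Fin N) ℝ) :
    ∑ j, B (∑ i, U i j • Ψ i) (∑ i, U i j • Ψ i) = ∑ i, B (Ψ i) (Ψ i) := by
  have hUU (k l : Fin N) : ∑ j, U k j * U l j = if k = l then 1 else 0 := by
    have h := congrFun (congrFun ((Matrix.mem_orthogonalGroup_iff _ _).1 hU) k) l
    simpa [Matrix.mul_apply, Matrix.one_apply] using h
  simp only [map_sum, map_smul, LinearMap.sum_apply, LinearMap.smul_apply, Finset.smul_sum,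
    smul_smul]
  rw [Finset.sum_comm]
  conv_lhs => enter [2, k]; rw [Finset.sum_comm]
  simp only [← Finset.sum_smul]
  conv_lhs => enter [2, k, 2, l, 1]; rw [Finset.sum_congr rfl fun j _ => mul_comm _ _, hUU]
  simp

theorem sum_orthogonal_clm (B : E →L[ℝ] E →L[ℝ] ℝ)
    (Ψ : Fin N → E) {U : Matrix (Fin N) (Fin N) ℝ} (hU : U ∈ Matrix.orthogonalGroup (Fin N) ℝ) :
    ∑ j, B (∑ i, U i j • Ψ i) (∑ i, U i j • Ψ i) = ∑ i, B (Ψ i) (Ψ i) :=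
  sum_orthogonal B.toLinearMap₁₂ Ψ hU

theorem sum_orthogonal_direct {f : E → E → E → E → ℝ} (hf : IsBoundedQuadrilinear f)
    (Ψ : Fin N → E) {U : Matrix (Fin N) (Fin N) ℝ} (hU : U ∈ Matrix.orthogonalGroup (Fin N) ℝ)
    (φ η : E) :
    ∑ j, f (∑ i, U i j • Ψ i) (∑ i, U i j • Ψ i) φ η = ∑ i, f (Ψ i) (Ψ i) φ η := by
  obtain ⟨D, hD⟩ := hf
  simp only [← hD]
  exact sum_orthogonal (LinearMap.mk₂ ℝ (fun c d => D c d φ η) (by simp) (by simp) (by simp)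
    (by simp)) Ψ hU

theorem sum_orthogonal_exchange {f : E → E → E → E → ℝ} (hf : IsBoundedQuadrilinear f)
    (Ψ : Fin N → E) {U : Matrix (Fin N) (Fin N) ℝ} (hU : U ∈ Matrix.orthogonalGroup (Fin N) ℝ)
    (φ η : E) :
    ∑ j, f (∑ i, U i j • Ψ i) φ (∑ i, U i j • Ψ i) η = ∑ i, f (Ψ i) φ (Ψ i) η := by
  obtain ⟨D, hD⟩ := hf
  simp only [← hD]
  exact sum_orthogonal (LinearMap.mk₂ ℝ (fun c d => D c φ d η) (by simp) (by simp) (by simp)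
    (by simp)) Ψ hU

/-- The energy `∑ᵢ (½ K(φᵢ, φᵢ) + V(φᵢ, φᵢ)) + ½ ∑ᵢⱼ f(φⱼ, φⱼ, φᵢ, φᵢ) - s ½ ∑ᵢⱼ f(φⱼ, φᵢ, φᵢ, φⱼ)`
of a tuple of orbitals; the weight `s` of the exchange term is `1` in Hartree–Fock theory and `0` in
the explicit part of the Kohn–Sham functional. -/
noncomputable def orbitalEnergy (K V : E →L[ℝ] E →L[ℝ] ℝ) (f : E → E → E → E → ℝ) (s : ℝ)
    (Φ : Fin N → E) : ℝ :=
  1 / 2 * (∑ i, K (Φ i) (Φ i)) + ∑ i, V (Φ i) (Φ i) + 1 / 2 * (∑ i, ∑ j, f (Φ j) (Φ j) (Φ i) (Φ i))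
    - s * (1 / 2 * ∑ i, ∑ j, f (Φ j) (Φ i) (Φ i) (Φ j))

/-- The orbital energy is differentiable; its gradient operator is symmetric, and both are invariant
under orthogonal transformations of the orbitals. -/
theorem exists_orbitalEnergy_gradient {K V : E →L[ℝ] E →L[ℝ] ℝ} {f : E → E → E → E → ℝ} (s : ℝ)
    (hK : ∀ φ η, K φ η = K η φ) (hV : ∀ φ η, V φ η = V η φ) (hf : IsBoundedQuadrilinear f)
    (h₁ : ∀ a b c d, f a b c d = f b a c d) (h₂ : ∀ a b c d, f a b c d = f c d a b) :
    ∃ A : (Fin N → E) → E →L[ℝ] E →L[ℝ] ℝ,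
      (∀ Φ φ η, A Φ φ η = 1 / 2 * K φ η + V φ η + ∑ j, f (Φ j) (Φ j) φ η
        - s * ∑ j, f (Φ j) φ (Φ j) η) ∧
      (∀ Φ, HasGradientAt (orbitalEnergy K V f s) (A Φ) Φ) ∧
      (∀ Φ φ η, A Φ φ η = A Φ η φ) ∧
      (∀ Φ : Fin N → E, ∀ U ∈ Matrix.orthogonalGroup (Fin N) ℝ,
        orbitalEnergy K V f s (fun j => ∑ i, U i j • Φ i) = orbitalEnergy K V f s Φ) ∧
      (∀ Φ : Fin N → E, ∀ U ∈ Matrix.orthogonalGroup (Fin N) ℝ,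
        A (fun j => ∑ i, U i j • Φ i) = A Φ) := by
  have h₃ (a b c d : E) : f a b c d = f a b d c := by rw [h₂, h₁, h₂]
  choose G hG using fun Φ : Fin N → E => exists_directOperator hf Φ
  choose X hX using fun Φ : Fin N → E => exists_exchangeOperator hf Φ
  have hGU (Φ : Fin N → E) (U) (hU : U ∈ Matrix.orthogonalGroup (Fin N) ℝ) :
      G (fun j => ∑ i, U i j • Φ i) = G Φ := by
    ext φ η
    rw [hG, hG]
    exact sum_orthogonal_direct hf Φ hU φ η
  have hXU (Φ : Fin N → E) (U) (hU : U ∈ Matrix.orthogonalGroup (Fin N) ℝ) :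
      X (fun j => ∑ i, U i j • Φ i) = X Φ := by
    ext φ η
    rw [hX, hX]
    exact sum_orthogonal_exchange hf Φ hU φ η
  have hJ (Φ : Fin N → E) : orbitalEnergy K V f s Φ = 1 / 2 * (∑ i, K (Φ i) (Φ i))
      + ∑ i, V (Φ i) (Φ i) + 1 / 2 * (∑ i, G Φ (Φ i) (Φ i))
      - s * (1 / 2 * (∑ i, X Φ (Φ i) (Φ i))) := by
    simp only [orbitalEnergy, hG, hX]
    refine congrArg₂ _ rfl (congrArg _ (congrArg _ ?_))
    exact Finset.sum_congr rfl fun i _ => Finset.sum_congr rfl fun j _ => h₃ _ _ _ _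
  have hA (Φ : Fin N → E) (φ η : E) : ((1 / 2 : ℝ) • K + V + G Φ - s • X Φ) φ η
      = 1 / 2 * K φ η + V φ η + ∑ j, f (Φ j) (Φ j) φ η - s * ∑ j, f (Φ j) φ (Φ j) η := by
    rw [← hG, ← hX]; rfl
  refine ⟨fun Φ => (1 / 2 : ℝ) • K + V + G Φ - s • X Φ, hA, fun Φ => ?_, fun Φ φ η => ?_,
    fun Φ U hU => ?_, fun Φ U hU => ?_⟩
  · exact ((((hasGradientAt_quadratic hK Φ).const_mul (1 / 2)).add
      (hasGradientAt_quadratic hV Φ)).add (hasGradientAt_direct hf h₁ h₂ (hG Φ))).sub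
      ((hasGradientAt_exchange hf h₁ h₂ (hX Φ)).const_mul s)
  · rw [hA, hA, hK φ, hV φ]
    refine congrArg₂ _ (congrArg₂ _ rfl ?_) (congrArg _ ?_)
    · exact Finset.sum_congr rfl fun j _ => h₃ _ _ _ _
    · exact Finset.sum_congr rfl fun j _ => h₂ _ _ _ _
  · rw [hJ, hJ, hGU Φ U hU, hXU Φ U hU]
    refine congrArg₂ _ (congrArg₂ _ (congrArg₂ _ (congrArg _ ?_) ?_) (congrArg _ ?_))
      (congrArg _ (congrArg _ ?_)) <;> exact sum_orthogonal_clm _ Φ hU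
  · simp only [hGU Φ U hU, hXU Φ U hU]

end Multilinear

/-! ### Minimisation over the Stiefel manifold -/

theorem toDual_comm (φ η : H1) : toDual φ η = toDual η φ := by
  rw [toDual_apply, toDual_apply]
  simp only [mul_comm]

theorem toDual_self_nonneg (φ : H1) : 0 ≤ toDual φ φ := by
  rw [toDual_apply]
  exact integral_nonneg fun x => mul_self_nonneg _

theorem toDual_add (φ ψ : H1) : toDual (φ + ψ) = toDual φ + toDual ψ := by
  ext η
  rw [add_apply, toDual_comm, map_add, toDual_comm η, toDual_comm η]

theorem toDual_smul (c : ℝ) (φ : H1) : toDual (c • φ) = c • toDual φ := by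
  ext η
  rw [smul_apply, toDual_comm, map_smul, toDual_comm η]

theorem mem_stiefel_iff {N : ℕ} {Φ : Fin N → H1} :
    Φ ∈ stiefel N ↔ ∀ i j, toDual (Φ i) (Φ j) = if i = j then 1 else 0 := by
  simp only [toDual_apply]
  rfl

theorem HasGradientAt.gradient_eq {N : ℕ} {J : (Fin N → H1) → ℝ} {A : H1 →L[ℝ] Hneg1}
    {Φ : Fin N → H1} (h : HasGradientAt J A Φ) : gradient J Φ = extend A Φ := by
  funext i
  ext η
  rw [gradient, h.fderiv]
  simp [extend, Pi.single_apply, apply_ite]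

theorem hasGradientOperator_of_hasGradientAt {N : ℕ} {J : (Fin N → H1) → ℝ}
    {A : (Fin N → H1) → H1 →L[ℝ] Hneg1} (h : ∀ Φ, HasGradientAt J (A Φ) Φ) :
    HasGradientOperator J A :=
  fun Φ => ⟨(h Φ).differentiableAt, (h Φ).gradient_eq⟩

/-- Replacing one member of an orthonormal tuple by `(ψᵢ + t η) / (1 + t² ‖η‖²)^(1/2)`, with `η`
orthogonal to the tuple, preserves orthonormality. -/
theorem update_mem_stiefel {N : ℕ} {Ψ : Fin N → H1} (hΨ : Ψ ∈ stiefel N) (i : Fin N) {η : H1}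
    (hη : ∀ k, toDual (Ψ k) η = 0) (t : ℝ) :
    Function.update Ψ i ((√(1 + t ^ 2 * toDual η η))⁻¹ • (Ψ i + t • η)) ∈ stiefel N := by
  rw [mem_stiefel_iff] at hΨ ⊢
  have hη' (k : Fin N) : toDual η (Ψ k) = 0 := by rw [toDual_comm, hη]
  have hpos : 0 < 1 + t ^ 2 * toDual η η := by
    have := toDual_self_nonneg η
    positivity
  have hsq : √(1 + t ^ 2 * toDual η η) * √(1 + t ^ 2 * toDual η η) = 1 + t ^ 2 * toDual η η :=
    Real.mul_self_sqrt hpos.le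
  have hsq0 : √(1 + t ^ 2 * toDual η η) ≠ 0 := (Real.sqrt_pos.2 hpos).ne'
  intro k l
  by_cases hk : k = i
  · subst hk
    by_cases hl : l = k
    · subst hl
      simp only [Function.update_self, toDual_smul, toDual_add, map_smul, map_add,
        smul_apply, add_apply, hη, hη', hΨ, smul_eq_mul,
        if_true]
      field_simp
      rw [sq, hsq]
      ring
    · simp [Function.update_of_ne hl, toDual_smul, toDual_add, hη', hΨ, Ne.symm hl]
  · by_cases hl : l = i
    · subst hl
      simp [hη, hΨ, hk]
    · rw [Function.update_of_ne hk, Function.update_of_ne hl, hΨ]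

/-- The Euler-Lagrange equation in the directions orthogonal to the minimizer. Only Fréchet
differentiability of `J` is needed, since it is tested along an explicit curve in the Stiefel
manifold. -/
theorem apply_eq_zero_of_isMinOn {N : ℕ} {J : (Fin N → H1) → ℝ} {A : H1 →L[ℝ] Hneg1}
    {Ψ : Fin N → H1} (hJ : HasGradientAt J A Ψ) (hΨ : Ψ ∈ stiefel N)
    (hmin : IsMinOn J (stiefel N) Ψ) (i : Fin N) {η : H1} (hη : ∀ k, toDual (Ψ k) η = 0) :
    A (Ψ i) η = 0 := by
  set c := toDual η η with hc
  let g : ℝ → H1 := fun t => (√(1 + t ^ 2 * c))⁻¹ • (Ψ i + t • η)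
  have hg0 : g 0 = Ψ i := by simp [g]
  have hg : HasDerivAt g η 0 := by
    have h1 : HasDerivAt (fun t : ℝ => 1 + t ^ 2 * c) 0 0 := by
      simpa using ((hasDerivAt_pow 2 (0 : ℝ)).mul_const c).const_add 1
    have h2 : HasDerivAt (fun t : ℝ => (√(1 + t ^ 2 * c))⁻¹) 0 0 := by
      simpa using (h1.sqrt (by simp)).fun_inv (by simp)
    have h3 : HasDerivAt (fun t : ℝ => Ψ i + t • η) η 0 := by
      simpa using ((hasDerivAt_id (0 : ℝ)).smul_const η).const_add (Ψ i)
    have h4 := h2.fun_smul h3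
    have h5 : (√(1 + (0 : ℝ) ^ 2 * c))⁻¹ • η + (0 : ℝ) • (Ψ i + (0 : ℝ) • η) = η := by simp
    rwa [h5] at h4
  let γ : ℝ → Fin N → H1 := fun t => Function.update Ψ i (g t)
  have hγ0 : γ 0 = Ψ := by simp [γ, hg0]
  have hγ : HasDerivAt γ (Pi.single i η) 0 := by
    rw [hasDerivAt_pi]
    intro k
    by_cases hk : k = i
    · subst hk
      simpa [γ] using hg
    · simpa [γ, hk] using hasDerivAt_const (0 : ℝ) (Ψ k)
  have hJγ := HasFDerivAt.comp_hasDerivAt (f := γ) (l := J) 0 (by rw [hγ0]; exact hJ) hγ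
  have hloc : IsLocalMin (J ∘ γ) 0 := by
    refine Eventually.of_forall fun t => ?_
    have h := hmin (update_mem_stiefel hΨ i hη t)
    change J (γ 0) ≤ J (γ t)
    rw [hγ0]
    exact h
  have := hloc.hasDerivAt_eq_zero hJγ
  simpa [Pi.single_apply, apply_ite] using this

/-- The Euler-Lagrange equation at a minimizer: an arbitrary direction differs from one orthogonal
to the tuple by its `L²` projection to the span. -/
theorem apply_eq_sum_of_isMinOn {N : ℕ} {J : (Fin N → H1) → ℝ} {A : H1 →L[ℝ] Hneg1}
    {Ψ : Fin N → H1} (hJ : HasGradientAt J A Ψ) (hΨ : Ψ ∈ stiefel N)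
    (hmin : IsMinOn J (stiefel N) Ψ) (i : Fin N) :
    A (Ψ i) = ∑ k, A (Ψ i) (Ψ k) • toDual (Ψ k) := by
  ext η
  have h := apply_eq_zero_of_isMinOn hJ hΨ hmin i
    (η := η - ∑ k, toDual (Ψ k) η • Ψ k) fun k => by
      rw [mem_stiefel_iff] at hΨ
      simp [hΨ]
  rw [map_sub, sub_eq_zero] at h
  rw [h]
  simp [mul_comm]

theorem isLagrangeMultiplier_iff {N : ℕ} {J : (Fin N → H1) → ℝ} {A : H1 →L[ℝ] Hneg1}
    {Ψ : Fin N → H1} (hJ : HasGradientAt J A Ψ) (hΨ : Ψ ∈ stiefel N)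
    (hmin : IsMinOn J (stiefel N) Ψ) (Λ : Matrix (Fin N) (Fin N) ℝ) :
    IsLagrangeMultiplier J Ψ Λ ↔ Λ = Matrix.of fun i j => A (Ψ i) (Ψ j) := by
  simp only [IsLagrangeMultiplier, hJ.gradient_eq, extend, sub_eq_zero]
  constructor
  · intro h
    ext i j
    rw [mem_stiefel_iff] at hΨ
    simp [h i, hΨ]
  · rintro rfl i
    exact apply_eq_sum_of_isMinOn hJ hΨ hmin i

/-- The Gram matrix of a bilinear form transforms by congruence. -/
theorem bilin_rightMul {N : ℕ} (B : H1 →L[ℝ] H1 →L[ℝ] ℝ) (Ψ : Fin N → H1)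
    (U : Matrix (Fin N) (Fin N) ℝ) (i j : Fin N) :
    B (rightMul Ψ U i) (rightMul Ψ U j)
      = (Uᵀ * (Matrix.of fun k l => B (Ψ k) (Ψ l)) * U) i j := by
  simp only [rightMul, map_sum, map_smul, sum_apply,
    smul_apply, smul_eq_mul, Matrix.mul_apply, Matrix.transpose_apply,
    Matrix.of_apply, Finset.sum_mul, Finset.mul_sum]
  refine Finset.sum_congr rfl fun k _ => Finset.sum_congr rfl fun l _ => ?_
  ring

/-- The `L²` inner product as a bounded bilinear form on `H¹`. -/
noncomputable def innerForm : H1 →L[ℝ] H1 →L[ℝ] ℝ :=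
  LinearMap.mkContinuous
    { toFun := toDual, map_add' := toDual_add, map_smul' := toDual_smul } 1 fun φ => by
    refine ContinuousLinearMap.opNorm_le_bound _ (by positivity) fun η => ?_
    change ‖inner ℝ φ.1.fst η.1.fst‖ ≤ _
    rw [one_mul]
    refine (norm_inner_le_norm _ _).trans ?_
    exact mul_le_mul (WithLp.norm_fst_le _ φ.1) (WithLp.norm_fst_le _ η.1) (norm_nonneg _)
      (norm_nonneg _)

theorem rightMul_mem_stiefel {N : ℕ} {Ψ : Fin N → H1} (hΨ : Ψ ∈ stiefel N)
    {U : Matrix (Fin N) (Fin N) ℝ} (hU : U ∈ Matrix.orthogonalGroup (Fin N) ℝ) :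
    rightMul Ψ U ∈ stiefel N := by
  rw [mem_stiefel_iff] at hΨ ⊢
  intro i j
  have h := bilin_rightMul innerForm Ψ U i j
  have h1 : (Matrix.of fun k l => innerForm (Ψ k) (Ψ l)) = 1 := by
    ext k l
    exact (hΨ k l).trans (Matrix.one_apply).symm
  rw [h1, Matrix.mul_one, show Uᵀ * U = 1 from (Matrix.mem_orthogonalGroup_iff' _ _).1 hU,
    Matrix.one_apply] at h
  exact h

theorem exists_orthogonal_diagonalization {N : ℕ} {Λ : Matrix (Fin N) (Fin N) ℝ}
    (hΛ : Λ.IsHermitian) :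
    ∃ U ∈ Matrix.orthogonalGroup (Fin N) ℝ, ∃ l : Fin N → ℝ, Uᵀ * Λ * U = Matrix.diagonal l := by
  obtain ⟨U, hU, l, hs⟩ : ∃ U ∈ Matrix.orthogonalGroup (Fin N) ℝ, ∃ l : Fin N → ℝ,
      Λ = U * Matrix.diagonal l * Uᵀ := by
    refine ⟨hΛ.eigenvectorUnitary.1, hΛ.eigenvectorUnitary.2, hΛ.eigenvalues, ?_⟩
    have := hΛ.spectral_theorem
    simpa [Unitary.conjStarAlgAut_apply, Matrix.star_eq_conjTranspose] using this
  have hUt : Uᵀ * U = 1 := (Matrix.mem_orthogonalGroup_iff' _ _).1 hU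
  refine ⟨U, hU, l, ?_⟩
  calc Uᵀ * Λ * U = (Uᵀ * U) * Matrix.diagonal l * (Uᵀ * U) := by
        rw [hs]; simp only [Matrix.mul_assoc]
    _ = Matrix.diagonal l := by rw [hUt, Matrix.one_mul, Matrix.mul_one]

/-- The canonical equations for a functional that is invariant under orthogonal changes of the
orbitals: the symmetric matrix `⟨A ψᵢ, ψⱼ⟩` is diagonalised by an orthogonal matrix. -/
theorem canonicalEquations_of_invariant {N : ℕ} {J : (Fin N → H1) → ℝ}
    {A : (Fin N → H1) → H1 →L[ℝ] Hneg1} (hgrad : ∀ Φ, HasGradientAt J (A Φ) Φ)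
    (hsymm : ∀ Φ φ η, A Φ φ η = A Φ η φ)
    (hJ : ∀ Φ, ∀ U ∈ Matrix.orthogonalGroup (Fin N) ℝ, J (rightMul Φ U) = J Φ)
    (hA : ∀ Φ, ∀ U ∈ Matrix.orthogonalGroup (Fin N) ℝ, A (rightMul Φ U) = A Φ) :
    CanonicalEquations J A := by
  intro Ψ hΨ hmin
  refine ⟨isLagrangeMultiplier_iff (hgrad Ψ) hΨ hmin, ?_⟩
  obtain ⟨U, hU, l, hdiag⟩ := exists_orthogonal_diagonalization
    (Λ := Matrix.of fun i j => A Ψ (Ψ i) (Ψ j)) (by ext i j; exact hsymm Ψ (Ψ j) (Ψ i))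
  have hmem := rightMul_mem_stiefel hΨ hU
  have hmin' : IsMinOn J (stiefel N) (rightMul Ψ U) := by
    intro Φ hΦ
    change J (rightMul Ψ U) ≤ J Φ
    rw [hJ Ψ U hU]
    exact hmin hΦ
  have hdiag' (i j : Fin N) : A Ψ (rightMul Ψ U i) (rightMul Ψ U j)
      = if i = j then l i else 0 := by
    rw [bilin_rightMul, hdiag, Matrix.diagonal_apply]
  refine ⟨U, hU, l, hmem, hmin', hA Ψ U hU, ?_, hdiag', fun i => ?_⟩
  · rw [isLagrangeMultiplier_iff (hgrad _) hmem hmin', hA Ψ U hU]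
    ext i j
    rw [Matrix.of_apply, hdiag', Matrix.diagonal_apply]
  · rw [apply_eq_sum_of_isMinOn (hgrad _) hmem hmin' i, hA Ψ U hU]
    simp only [hdiag', ite_smul, zero_smul, Finset.sum_ite_eq, Finset.mem_univ, if_true]

/-! ### Bounded multilinear forms on `H¹` -/

theorem h1_add_ae (φ ψ : H1) : (φ + ψ : H1) =ᵐ[volume] fun x => φ x + ψ x :=
  Lp.coeFn_add φ.1.fst ψ.1.fst

theorem h1_smul_ae (c : ℝ) (φ : H1) : (c • φ : H1) =ᵐ[volume] fun x => c * φ x :=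
  Lp.coeFn_smul c φ.1.fst

/-- The bounded bilinear form `∫ w φ η` of a potential `w`. -/
theorem exists_potentialForm {w : E3 → ℝ} {C : ℝ}
    (hw : ∀ φ η : H1, Integrable (fun x => w x * φ x * η x) volume)
    (hC : ∀ φ η : H1, ‖∫ x, w x * φ x * η x‖ ≤ C * ‖φ‖ * ‖η‖) :
    ∃ B : H1 →L[ℝ] H1 →L[ℝ] ℝ, ∀ φ η : H1, B φ η = ∫ x, w x * φ x * η x := by
  refine exists_symm_bilin (fun φ η : H1 => ∫ x, w x * φ x * η x) (fun a b c => ?_)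
    (fun r a c => ?_) (fun a b => ?_) C hC
  · rw [← integral_add (hw a c) (hw b c)]
    refine integral_congr_ae ?_
    filter_upwards [h1_add_ae a b] with x hx
    rw [hx]; ring
  · rw [smul_eq_mul, ← integral_const_mul]
    refine integral_congr_ae ?_
    filter_upwards [h1_smul_ae r a] with x hx
    rw [hx]; ring
  · refine integral_congr_ae (Eventually.of_forall fun x => ?_)
    ring

theorem integral_potential_comm (w : E3 → ℝ) (φ η : H1) :
    ∫ x, w x * φ x * η x = ∫ x, w x * η x * φ x :=
  integral_congr_ae (Eventually.of_forall fun x => mul_right_comm (w x) (φ x) (η x))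

/-- Elements of `L^∞ + L^{3/2}` define bounded functionals on `L¹ ∩ L³`. -/
theorem exists_memDual_bound {v : E3 → ℝ} (hv : MemDual v) : ∃ K : ℝ, 0 ≤ K ∧ ∀ h : E3 → ℝ,
    MemLp h 1 volume → MemLp h 3 volume → Integrable (fun x => v x * h x) volume ∧
      ‖∫ x, v x * h x‖ ≤ K * normL1L3 h := by
  obtain ⟨v₁, v₂, h₁, h₂, rfl⟩ := hv
  refine ⟨(eLpNorm v₁ ∞ volume).toReal + (eLpNorm v₂ (3 / 2) volume).toReal, by positivity,
    fun h h1 h3 => ?_⟩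
  have key := integrable_mul_and_integral_norm_le h₁ h₂ h1 h3
  exact ⟨key.1, (norm_integral_le_integral_norm _).trans key.2⟩

/-- Elements of `L^∞ + L^{3/2}` define bounded bilinear forms on `H¹`. -/
theorem exists_memDualForm {v : E3 → ℝ} (hv : MemDual v) :
    (∀ φ η : H1, Integrable (fun x => v x * φ x * η x) volume) ∧
    ∃ B : H1 →L[ℝ] H1 →L[ℝ] ℝ, ∀ φ η : H1, B φ η = ∫ x, v x * φ x * η x := by
  obtain ⟨K, hK0, hK⟩ := exists_memDual_bound hv
  obtain ⟨C, hC0, hC⟩ := exists_normL1L3_mul_le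
  have h (φ η : H1) := hK _ (memLp_one_mul φ η) (memLp_three_mul φ η)
  simp only [← mul_assoc] at h
  refine ⟨fun φ η => (h φ η).1, exists_potentialForm (C := K * C) (fun φ η => (h φ η).1)
    fun φ η => (h φ η).2.trans ?_⟩
  rw [mul_assoc K, mul_assoc K]
  exact mul_le_mul_of_nonneg_left (hC φ η) hK0

theorem exists_coulomb_mul_bound : ∃ C : ℝ, 0 ≤ C ∧ ∀ (φ η : H1) (x : E3),
    Integrable (fun y => φ y * η y / ‖x - y‖) volume ∧
      ∫ y, ‖φ y * η y / ‖x - y‖‖ ≤ C * ‖φ‖ * ‖η‖ := by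
  obtain ⟨K, hK0, hK⟩ := exists_coulomb_bound
  obtain ⟨C, hC0, hC⟩ := exists_normL1L3_mul_le
  refine ⟨K * C, by positivity, fun φ η x => ?_⟩
  have h := hK _ x (memLp_one_mul φ η) (memLp_three_mul φ η)
  refine ⟨h.1, h.2.trans ?_⟩
  rw [mul_assoc K, mul_assoc K]
  exact mul_le_mul_of_nonneg_left (hC φ η) hK0

theorem integrable_coulomb (φ η : H1) (x : E3) :
    Integrable (fun y => φ y * η y / ‖x - y‖) volume := by
  obtain ⟨C, -, hC⟩ := exists_coulomb_mul_bound
  exact (hC φ η x).1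

theorem exists_norm_coulomb_le : ∃ C : ℝ, 0 ≤ C ∧ ∀ (φ η : H1) (x : E3),
    ‖coulomb (fun y => φ y * η y) x‖ ≤ C * ‖φ‖ * ‖η‖ := by
  obtain ⟨C, hC0, hC⟩ := exists_coulomb_mul_bound
  exact ⟨C, hC0, fun φ η x => (norm_integral_le_integral_norm _).trans (hC φ η x).2⟩

/-- The nuclear attraction is a bounded form, being a sum of Coulomb potentials of `φ η` evaluated
at the nuclei. -/
theorem exists_nuclearForm {M : ℕ} (Z : Fin M → ℝ) (R : Fin M → E3) :
    (∀ φ η : H1, Integrable (fun x => nuclearPotential Z R x * φ x * η x) volume) ∧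
    ∃ B : H1 →L[ℝ] H1 →L[ℝ] ℝ, ∀ φ η : H1, B φ η = ∫ x, nuclearPotential Z R x * φ x * η x := by
  obtain ⟨C, hC0, hC⟩ := exists_coulomb_mul_bound
  have hint (ν : Fin M) (φ η : H1) : Integrable (fun x => 1 / ‖x - R ν‖ * φ x * η x) volume := by
    refine (hC φ η (R ν)).1.congr (Eventually.of_forall fun x => ?_)
    simp only [norm_sub_rev (R ν)]; ring
  have hB (ν : Fin M) : ∃ B : H1 →L[ℝ] H1 →L[ℝ] ℝ,
      ∀ φ η : H1, B φ η = ∫ x, 1 / ‖x - R ν‖ * φ x * η x := by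
    refine exists_potentialForm (hint ν) (C := C) fun φ η => ?_
    refine (norm_integral_le_integral_norm _).trans (le_trans (le_of_eq ?_) (hC φ η (R ν)).2)
    refine integral_congr_ae (Eventually.of_forall fun x => ?_)
    simp only [norm_sub_rev (R ν)]
    congr 1; ring
  choose B hB using hB
  have heq (φ η : H1) : (fun x => nuclearPotential Z R x * φ x * η x)
      = fun x => ∑ ν, (-Z ν) * (1 / ‖x - R ν‖ * φ x * η x) := by
    ext x
    rw [nuclearPotential, ← Finset.sum_neg_distrib, Finset.sum_mul, Finset.sum_mul]
    refine Finset.sum_congr rfl fun ν _ => ?_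
    ring
  refine ⟨fun φ η => ?_, ∑ ν, (-Z ν) • B ν, fun φ η => ?_⟩
  · rw [heq]
    exact integrable_finsetSum _ fun ν _ => (hint ν φ η).const_mul _
  · have h := integral_finsetSum (μ := volume) Finset.univ
      (f := fun ν x => (-Z ν) * (1 / ‖x - R ν‖ * φ x * η x))
      fun ν _ => (hint ν φ η).const_mul (-Z ν)
    have h2 (ν : Fin M) : (-Z ν) * B ν φ η = ∫ x, (-Z ν) * (1 / ‖x - R ν‖ * φ x * η x) := by
      rw [hB, integral_const_mul]
    calc (∑ ν, (-Z ν) • B ν) φ η = ∑ ν, (-Z ν) * B ν φ η := sum_smul_bilin_apply _ _ _ _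
      _ = ∑ ν, ∫ x, (-Z ν) * (1 / ‖x - R ν‖ * φ x * η x) := Finset.sum_congr rfl fun ν _ => h2 ν
      _ = ∫ x, ∑ ν, (-Z ν) * (1 / ‖x - R ν‖ * φ x * η x) := h.symm
      _ = ∫ x, nuclearPotential Z R x * φ x * η x :=
        integral_congr_ae (Eventually.of_forall fun x => (congrFun (heq φ η) x).symm)

theorem symm_of_kineticForm {K : H1 →L[ℝ] H1 →L[ℝ] ℝ}
    (hK : ∀ φ η : H1, K φ η = ∫ x, inner ℝ (grad φ x) (grad η x)) (φ η : H1) : K φ η = K η φ :=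
  (hK φ η).trans ((integral_congr_ae (Eventually.of_forall fun _ => real_inner_comm _ _)).trans
    (hK η φ).symm)

theorem symm_of_potentialForm {w : E3 → ℝ} {V : H1 →L[ℝ] H1 →L[ℝ] ℝ}
    (hV : ∀ φ η : H1, V φ η = ∫ x, w x * φ x * η x) (φ η : H1) : V φ η = V η φ :=
  (hV φ η).trans ((integral_potential_comm w φ η).trans (hV η φ).symm)

theorem aestronglyMeasurable_coulomb {f : E3 → ℝ} (hf : AEStronglyMeasurable f volume) :
    AEStronglyMeasurable (coulomb f) volume := by
  have h1 : AEStronglyMeasurable (fun p : E3 × E3 => f p.2 / ‖p.1 - p.2‖)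
      (volume.prod volume) := by
    refine (hf.comp_quasiMeasurePreserving Measure.quasiMeasurePreserving_snd).div₀ ?_
    exact (measurable_fst.sub measurable_snd).norm.aestronglyMeasurable
  exact h1.integral_prod_right'

/-- The product is integrable because the Coulomb potential is bounded and `a b ∈ L¹`. -/
theorem integrable_coulomb_mul (c d a b : H1) :
    Integrable (fun x => coulomb (fun y => c y * d y) x * a x * b x) volume := by
  obtain ⟨C, -, hC⟩ := exists_norm_coulomb_le
  have h := (memLp_one_iff_integrable.1 (memLp_one_mul a b)).bdd_mul
    (aestronglyMeasurable_coulomb (memLp_one_mul c d).1)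
    (Eventually.of_forall fun x => hC c d x)
  simpa only [mul_assoc] using h

theorem integral_norm_mul_le (a b : H1) : ∫ x, ‖a x * b x‖ ≤ ‖a‖ * ‖b‖ := by
  have h := (eLpNorm_mul_le 2 2 1 (memLp_two a).1 (memLp_two b).1).trans
    (mul_le_mul' (eLpNorm_le_enorm a) (eLpNorm_le_enorm b))
  rw [integral_norm_eq_lintegral_enorm (memLp_one_mul a b).1, ← eLpNorm_one_eq_lintegral_enorm]
  simpa using ENNReal.toReal_mono (by finiteness) h

theorem coulomb_add_mul (c c' d : H1) (x : E3) : coulomb (fun y => (c + c' : H1) y * d y) x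
    = coulomb (fun y => c y * d y) x + coulomb (fun y => c' y * d y) x := by
  unfold coulomb
  rw [← integral_add (integrable_coulomb c d x) (integrable_coulomb c' d x)]
  refine integral_congr_ae ?_
  filter_upwards [h1_add_ae c c'] with y hy
  rw [hy]; ring

theorem coulomb_smul_mul (r : ℝ) (c d : H1) (x : E3) :
    coulomb (fun y => (r • c : H1) y * d y) x = r * coulomb (fun y => c y * d y) x := by
  unfold coulomb
  rw [← integral_const_mul]
  refine integral_congr_ae ?_
  filter_upwards [h1_smul_ae r c] with y hy
  rw [hy]; ring

/-- The Coulomb energy `∬ c(y) d(y) a(x) b(x) / |x - y| dy dx`. -/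
noncomputable def coulombForm (c d a b : H1) : ℝ :=
  ∫ x, coulomb (fun y => c y * d y) x * a x * b x

theorem isBoundedQuadrilinear_coulombForm : IsBoundedQuadrilinear coulombForm := by
  obtain ⟨C, hC0, hC⟩ := exists_norm_coulomb_le
  have hbound (c d a b : H1) : ‖coulombForm c d a b‖ ≤ C * ‖c‖ * ‖d‖ * ‖a‖ * ‖b‖ := by
    refine (norm_integral_le_of_norm_le
      ((memLp_one_iff_integrable.1 (memLp_one_mul a b)).norm.const_mul (C * ‖c‖ * ‖d‖))
      (Eventually.of_forall fun x => ?_)).trans ?_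
    · rw [mul_assoc, norm_mul]
      exact mul_le_mul_of_nonneg_right (hC c d x) (norm_nonneg _)
    · rw [integral_const_mul, mul_assoc (C * ‖c‖ * ‖d‖)]
      exact mul_le_mul_of_nonneg_left (integral_norm_mul_le a b) (by positivity)
  refine isBoundedQuadrilinear_of_bound
    (fun c d => exists_potentialForm (integrable_coulomb_mul c d) (hbound c d))
    (fun c c' d a b => ?_) (fun r c d a b => ?_) (fun c d a b => ?_) hC0 hbound
  · rw [coulombForm, coulombForm, coulombForm,
      ← integral_add (integrable_coulomb_mul c d a b) (integrable_coulomb_mul c' d a b)]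
    refine integral_congr_ae (Eventually.of_forall fun x => ?_)
    simp only [coulomb_add_mul, add_mul]
  · rw [coulombForm, coulombForm, ← integral_const_mul]
    refine integral_congr_ae (Eventually.of_forall fun x => ?_)
    simp only [coulomb_smul_mul, mul_assoc]
  · simp only [coulombForm, mul_comm (c _)]

theorem coulombForm_swap (c d a b : H1) : coulombForm c d a b = coulombForm d c a b := by
  simp only [coulombForm, mul_comm (c _)]

/-- The Coulomb energy is symmetric in the two charge densities, by Fubini's theorem. -/
theorem coulombForm_comm (c d a b : H1) : coulombForm c d a b = coulombForm a b c d := by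
  have hmeas : AEStronglyMeasurable
      (fun p : E3 × E3 => (a p.1 * b p.1) * (c p.2 * d p.2 / ‖p.1 - p.2‖))
      (volume.prod volume) := by
    refine ((memLp_one_mul a b).1.comp_quasiMeasurePreserving
      Measure.quasiMeasurePreserving_fst).mul ?_
    refine ((memLp_one_mul c d).1.comp_quasiMeasurePreserving
      Measure.quasiMeasurePreserving_snd).div₀ ?_
    exact (measurable_fst.sub measurable_snd).norm.aestronglyMeasurable
  have hint : Integrable
      (fun p : E3 × E3 => (a p.1 * b p.1) * (c p.2 * d p.2 / ‖p.1 - p.2‖))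
      (volume.prod volume) := by
    obtain ⟨C, hC0, hC⟩ := exists_coulomb_mul_bound
    rw [integrable_prod_iff hmeas]
    refine ⟨Eventually.of_forall fun x =>
      (integrable_coulomb c d x).const_mul (a x * b x), ?_⟩
    simp only [norm_mul (a _ * b _), integral_const_mul]
    have h1 : AEStronglyMeasurable (fun x => ∫ y, ‖c y * d y / ‖x - y‖‖) volume := by
      have h2 : AEStronglyMeasurable (fun p : E3 × E3 => ‖c p.2 * d p.2 / ‖p.1 - p.2‖‖)
          (volume.prod volume) := by
        refine AEStronglyMeasurable.norm ?_
        refine ((memLp_one_mul c d).1.comp_quasiMeasurePreserving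
          Measure.quasiMeasurePreserving_snd).div₀ ?_
        exact (measurable_fst.sub measurable_snd).norm.aestronglyMeasurable
      exact h2.integral_prod_right'
    refine (memLp_one_iff_integrable.1 (memLp_one_mul a b)).norm.mul_bdd (c := C * ‖c‖ * ‖d‖) h1
      (Eventually.of_forall fun x => ?_)
    rw [Real.norm_of_nonneg (integral_nonneg fun _ => norm_nonneg _)]
    exact (hC c d x).2
  have hswap := integral_integral_swap (f := fun x y => (a x * b x) * (c y * d y / ‖x - y‖)) hint
  have e1 (x : E3) : coulomb (fun y => c y * d y) x * a x * b x
      = ∫ y, (a x * b x) * (c y * d y / ‖x - y‖) := by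
    rw [integral_const_mul, coulomb]; ring
  have e2 (y : E3) : coulomb (fun x => a x * b x) y * c y * d y
      = ∫ x, (a x * b x) * (c y * d y / ‖x - y‖) := by
    rw [mul_assoc, coulomb, ← integral_mul_const]
    refine integral_congr_ae (Eventually.of_forall fun x => ?_)
    simp only [norm_sub_rev x y]; ring
  simp only [coulombForm, e1, e2]
  exact hswap

/-- The Dirichlet form `∫ ∇φ · ∇η`. -/
theorem exists_kineticForm : ∃ B : H1 →L[ℝ] H1 →L[ℝ] ℝ, ∀ φ η : H1,
    B φ η = ∫ x, inner ℝ (grad φ x) (grad η x) := by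
  obtain ⟨B, hB⟩ := exists_symm_bilin (fun φ η : H1 => inner ℝ φ.1.snd η.1.snd)
    (fun a b c => inner_add_left _ _ _) (fun r a c => real_inner_smul_left _ _ _)
    (fun a b => real_inner_comm _ _) 1 (fun a b => by
      rw [one_mul]
      refine (norm_inner_le_norm _ _).trans ?_
      exact mul_le_mul (WithLp.norm_snd_le _ a.1) (WithLp.norm_snd_le _ b.1) (norm_nonneg _)
        (norm_nonneg _))
  exact ⟨B, fun φ η => by rw [hB, L2.inner_def]; rfl⟩

theorem integrable_norm_grad_sq (φ : H1) : Integrable (fun x => ‖grad φ x‖ ^ 2) volume :=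
  (memLp_two_iff_integrable_sq_norm (Lp.aestronglyMeasurable _)).1 (Lp.memLp φ.1.snd)

/-! ### The Hartree–Fock functional -/

section Functionals

variable {N M : ℕ}

theorem coulomb_density (Φ : Fin N → H1) (x : E3) :
    coulomb (density Φ) x = ∑ j, coulomb (fun y => Φ j y * Φ j y) x := by
  have h := integral_finsetSum (μ := volume) Finset.univ
    (f := fun j y => Φ j y * Φ j y / ‖x - y‖) fun j _ => integrable_coulomb (Φ j) (Φ j) x
  refine Eq.trans (integral_congr_ae (Eventually.of_forall fun y => ?_)) h
  simp only [density, densityMatrix, Finset.sum_div]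

theorem exchange_eq (Φ : Fin N → H1) (φ : H1) (x : E3) :
    exchange Φ φ x = ∑ j, coulomb (fun y => Φ j y * φ y) x * Φ j x := by
  have h := integral_finsetSum (μ := volume) Finset.univ
    (f := fun j y => Φ j y * φ y / ‖x - y‖ * Φ j x)
    fun j _ => (integrable_coulomb (Φ j) φ x).mul_const (Φ j x)
  refine Eq.trans (integral_congr_ae (Eventually.of_forall fun y => ?_)) (h.trans ?_)
  · simp only [densityMatrix, Finset.sum_mul, Finset.sum_div]
    refine Finset.sum_congr rfl fun j _ => ?_
    ring
  · refine Finset.sum_congr rfl fun j _ => ?_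
    rw [integral_mul_const, coulomb]

theorem hfIntegrand_eq (Z : Fin M → ℝ) (R : Fin M → E3) (Φ : Fin N → H1) (i : Fin N) (x : E3) :
    hfIntegrand Z R Φ i x = 1 / 2 * ‖grad (Φ i) x‖ ^ 2 + nuclearPotential Z R x * Φ i x * Φ i x
      + 1 / 2 * (∑ j, coulomb (fun y => Φ j y * Φ j y) x * Φ i x * Φ i x)
      - 1 / 2 * (∑ j, coulomb (fun y => Φ j y * Φ i y) x * Φ i x * Φ j x) := by
  have h1 (j : Fin N) : (∫ y, |Φ j y| ^ 2 / ‖x - y‖) * |Φ i x| ^ 2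
      = coulomb (fun y => Φ j y * Φ j y) x * Φ i x * Φ i x := by
    simp only [sq, abs_mul_abs_self, coulomb]; ring
  have h2 (j : Fin N) : ∫ y, Φ i x * Φ j x * Φ j y * Φ i y / ‖x - y‖
      = coulomb (fun y => Φ j y * Φ i y) x * Φ i x * Φ j x := by
    rw [coulomb, mul_assoc, ← integral_mul_const]
    refine integral_congr_ae (Eventually.of_forall fun y => ?_)
    ring
  rw [hfIntegrand, Finset.sum_congr rfl fun j _ => h1 j, Finset.sum_congr rfl fun j _ => h2 j,
    sq_abs]
  ring

theorem integrable_hfIntegrand (Z : Fin M → ℝ) (R : Fin M → E3) (Φ : Fin N → H1) (i : Fin N) :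
    Integrable (hfIntegrand Z R Φ i) volume := by
  have i1 := (integrable_norm_grad_sq (Φ i)).const_mul (1 / 2)
  have i2 := (exists_nuclearForm Z R).1 (Φ i) (Φ i)
  have i3 := (integrable_finsetSum Finset.univ fun j _ =>
    integrable_coulomb_mul (Φ j) (Φ j) (Φ i) (Φ i)).const_mul (1 / 2)
  have i4 := (integrable_finsetSum Finset.univ fun j _ =>
    integrable_coulomb_mul (Φ j) (Φ i) (Φ i) (Φ j)).const_mul (1 / 2)
  exact (((i1.add i2).add i3).sub i4).congr
    (Eventually.of_forall fun x => (hfIntegrand_eq Z R Φ i x).symm)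

theorem integral_hfIntegrand (Z : Fin M → ℝ) (R : Fin M → E3) (Φ : Fin N → H1) (i : Fin N) :
    ∫ x, hfIntegrand Z R Φ i x = 1 / 2 * (∫ x, ‖grad (Φ i) x‖ ^ 2)
      + (∫ x, nuclearPotential Z R x * Φ i x * Φ i x)
      + 1 / 2 * (∑ j, coulombForm (Φ j) (Φ j) (Φ i) (Φ i))
      - 1 / 2 * (∑ j, coulombForm (Φ j) (Φ i) (Φ i) (Φ j)) := by
  have i1 := (integrable_norm_grad_sq (Φ i)).const_mul (1 / 2)
  have i2 := (exists_nuclearForm Z R).1 (Φ i) (Φ i)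
  have j3 (j : Fin N) := integrable_coulomb_mul (Φ j) (Φ j) (Φ i) (Φ i)
  have j4 (j : Fin N) := integrable_coulomb_mul (Φ j) (Φ i) (Φ i) (Φ j)
  have i3 := (integrable_finsetSum Finset.univ fun j _ => j3 j).const_mul (1 / 2)
  have i4 := (integrable_finsetSum Finset.univ fun j _ => j4 j).const_mul (1 / 2)
  have e3 := integral_finsetSum Finset.univ fun j _ => j3 j
  have e4 := integral_finsetSum Finset.univ fun j _ => j4 j
  have h := integral_congr_ae (μ := (volume : Measure E3))
    (Eventually.of_forall (hfIntegrand_eq Z R Φ i))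
  refine h.trans ((integral_sub ((i1.add i2).add i3) i4).trans ?_)
  refine congrArg₂ _ ((integral_add (i1.add i2) i3).trans
    (congrArg₂ _ ((integral_add i1 i2).trans (congrArg₂ _ ?_ rfl)) ?_)) ?_
  · exact integral_const_mul _ _
  · exact (integral_const_mul _ _).trans (congrArg _ e3)
  · exact (integral_const_mul _ _).trans (congrArg _ e4)

theorem integral_coulomb_density_mul (Φ : Fin N → H1) (φ η : H1) :
    Integrable (fun x => coulomb (density Φ) x * φ x * η x) volume ∧
      ∫ x, coulomb (density Φ) x * φ x * η x = ∑ j, coulombForm (Φ j) (Φ j) φ η := by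
  have hi (j : Fin N) := integrable_coulomb_mul (Φ j) (Φ j) φ η
  have heq (x : E3) : ∑ j, coulomb (fun y => Φ j y * Φ j y) x * φ x * η x
      = coulomb (density Φ) x * φ x * η x := by
    rw [coulomb_density, Finset.sum_mul, Finset.sum_mul]
  exact ⟨(integrable_finsetSum Finset.univ fun j _ => hi j).congr (Eventually.of_forall heq),
    (integral_congr_ae (Eventually.of_forall heq)).symm.trans
      (integral_finsetSum Finset.univ fun j _ => hi j)⟩

theorem integral_exchange_mul (Φ : Fin N → H1) (φ η : H1) :
    Integrable (fun x => exchange Φ φ x * η x) volume ∧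
      ∫ x, exchange Φ φ x * η x = ∑ j, coulombForm (Φ j) φ (Φ j) η := by
  have hi (j : Fin N) := integrable_coulomb_mul (Φ j) φ (Φ j) η
  have heq (x : E3) : ∑ j, coulomb (fun y => Φ j y * φ y) x * Φ j x * η x
      = exchange Φ φ x * η x := by
    rw [exchange_eq, Finset.sum_mul]
  exact ⟨(integrable_finsetSum Finset.univ fun j _ => hi j).congr (Eventually.of_forall heq),
    (integral_congr_ae (Eventually.of_forall heq)).symm.trans
      (integral_finsetSum Finset.univ fun j _ => hi j)⟩

theorem hartreeFock_eq (Z : Fin M → ℝ) (R : Fin M → E3) {K V : H1 →L[ℝ] H1 →L[ℝ] ℝ}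
    (hK : ∀ φ η : H1, K φ η = ∫ x, inner ℝ (grad φ x) (grad η x))
    (hV : ∀ φ η : H1, V φ η = ∫ x, nuclearPotential Z R x * φ x * η x) (Φ : Fin N → H1) :
    hartreeFock Z R Φ = orbitalEnergy K V coulombForm 1 Φ := by
  have hK' (φ : H1) : K φ φ = ∫ x, ‖grad φ x‖ ^ 2 :=
    (hK φ φ).trans (integral_congr_ae (Eventually.of_forall fun _ => real_inner_self_eq_norm_sq _))
  simp only [hartreeFock, orbitalEnergy, integral_hfIntegrand, Finset.sum_add_distrib,
    Finset.sum_sub_distrib, ← Finset.mul_sum, hK', hV, one_mul]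

theorem isFockOperator_of_forall (Z : Fin M → ℝ) (R : Fin M → E3) {K V : H1 →L[ℝ] H1 →L[ℝ] ℝ}
    (hK : ∀ φ η : H1, K φ η = ∫ x, inner ℝ (grad φ x) (grad η x))
    (hV : ∀ φ η : H1, V φ η = ∫ x, nuclearPotential Z R x * φ x * η x) (Φ : Fin N → H1)
    {A : H1 →L[ℝ] H1 →L[ℝ] ℝ} (hA : ∀ φ η, A φ η = 1 / 2 * K φ η + V φ η
      + ∑ j, coulombForm (Φ j) (Φ j) φ η - 1 * ∑ j, coulombForm (Φ j) φ (Φ j) η) :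
    IsFockOperator Z R Φ A := by
  intro φ η
  have i0 := (exists_nuclearForm Z R).1 φ η
  obtain ⟨i1, e1⟩ := integral_coulomb_density_mul Φ φ η
  obtain ⟨i2, e2⟩ := integral_exchange_mul Φ φ η
  have heq (x : E3) : nuclearPotential Z R x * φ x * η x + coulomb (density Φ) x * φ x * η x
      - exchange Φ φ x * η x = (nuclearPotential Z R x * φ x + coulomb (density Φ) x * φ x
      - exchange Φ φ x) * η x := by ring
  refine ⟨((i0.add i1).sub i2).congr (Eventually.of_forall heq), ?_⟩
  have h : ∫ x, (nuclearPotential Z R x * φ x + coulomb (density Φ) x * φ x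
      - exchange Φ φ x) * η x = (∫ x, nuclearPotential Z R x * φ x * η x)
        + (∑ j, coulombForm (Φ j) (Φ j) φ η) - ∑ j, coulombForm (Φ j) φ (Φ j) η :=
    (integral_congr_ae (Eventually.of_forall heq)).symm.trans
      ((integral_sub (i0.add i1) i2).trans
        (congrArg₂ (· - ·) ((integral_add i0 i1).trans (congrArg _ e1)) e2))
  refine (hA φ η).trans (Eq.trans ?_ (congrArg _ h.symm))
  have hKe := hK φ η
  have hVe := hV φ η
  linarith

/-- The Hartree–Fock functional is differentiable with the Fock operator as gradient operator, and
its minimizers satisfy the canonical Hartree–Fock equations. -/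
theorem hartreeFock_canonical (N : ℕ) (Z : Fin M → ℝ) (R : Fin M → E3) :
    ∃ A : (Fin N → H1) → H1 →L[ℝ] Hneg1,
      (∀ Φ, IsFockOperator Z R Φ (A Φ)) ∧
      HasGradientOperator (hartreeFock Z R) A ∧
      CanonicalEquations (hartreeFock Z R) A := by
  obtain ⟨K, hK⟩ := exists_kineticForm
  obtain ⟨-, V, hV⟩ := exists_nuclearForm Z R
  have hJ : hartreeFock Z R = orbitalEnergy (N := N) K V coulombForm 1 :=
    funext (hartreeFock_eq Z R hK hV)
  obtain ⟨A, hA, hgrad, hsymm, hinv, hAinv⟩ := exists_orbitalEnergy_gradient (N := N) 1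
    (symm_of_kineticForm hK) (symm_of_potentialForm hV) isBoundedQuadrilinear_coulombForm
    coulombForm_swap coulombForm_comm
  rw [hJ]
  exact ⟨A, fun Φ => isFockOperator_of_forall Z R hK hV Φ (hA Φ),
    hasGradientOperator_of_hasGradientAt hgrad,
    canonicalEquations_of_invariant hgrad hsymm hinv hAinv⟩

/-! ### The Kohn–Sham functional -/

theorem h1_sum_ae {ι : Type*} (s : Finset ι) (c : ι → ℝ) (Φ : ι → H1) :
    (∑ i ∈ s, c i • Φ i : H1) =ᵐ[volume] fun x => ∑ i ∈ s, c i * Φ i x := by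
  classical
  induction s using Finset.induction_on with
  | empty =>
    simp only [Finset.sum_empty]
    exact Lp.coeFn_zero _ _ _
  | insert i s hi ih =>
    rw [Finset.sum_insert hi]
    filter_upwards [h1_add_ae (c i • Φ i) (∑ i ∈ s, c i • Φ i), h1_smul_ae (c i) (Φ i), ih]
      with x h1 h2 h3
    rw [h1, h2, h3, Finset.sum_insert hi]

theorem densityClass_rightMul (Φ : Fin N → H1) {U : Matrix (Fin N) (Fin N) ℝ}
    (hU : U ∈ Matrix.orthogonalGroup (Fin N) ℝ) :
    densityClass (rightMul Φ U) = densityClass Φ := by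
  refine AEEqFun.mk_eq_mk.2 ?_
  have h (j : Fin N) := h1_sum_ae Finset.univ (fun i => U i j) Φ
  filter_upwards [ae_all_iff.2 h] with x hx
  have h1 (j : Fin N) : rightMul Φ U j x = ∑ i, U i j • Φ i x := hx j
  simp only [density, densityMatrix, h1]
  exact sum_orthogonal (LinearMap.mul ℝ ℝ) (fun i => Φ i x) hU

theorem memLp_density_one (Φ : Fin N → H1) : MemLp (density Φ) 1 volume :=
  memLp_finsetSum Finset.univ fun i _ => memLp_one_mul (Φ i) (Φ i)

theorem memLp_density_three (Φ : Fin N → H1) : MemLp (density Φ) 3 volume :=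
  memLp_finsetSum Finset.univ fun i _ => memLp_three_mul (Φ i) (Φ i)

theorem densityClass_mem_densities (Φ : Fin N → H1) : densityClass Φ ∈ densities := by
  have hae : densityClass Φ =ᵐ[volume] density Φ := AEEqFun.coeFn_mk _ _
  refine ⟨?_, (memLp_congr_ae hae).2 (memLp_density_one Φ),
    (memLp_congr_ae hae).2 (memLp_density_three Φ)⟩
  rw [← AEEqFun.coeFn_le]
  filter_upwards [hae, AEEqFun.coeFn_zero (α := E3) (β := ℝ) (μ := volume)] with x h1 h2
  rw [h1, h2]
  have h3 : 0 ≤ ∑ i, Φ i x * Φ i x := Finset.sum_nonneg fun i _ => mul_self_nonneg _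
  exact h3

/-- The increment of the density, `n_{Φ+h} - n_Φ = ∑ᵢ (2φᵢ + hᵢ) hᵢ`. -/
theorem densityClass_add_sub_ae (Φ h : Fin N → H1) :
    (densityClass (Φ + h) - densityClass Φ : E3 →ₘ[volume] ℝ)
      =ᵐ[volume] fun x => ∑ i, ((2 : ℝ) • Φ i + h i : H1) x * h i x := by
  have h1 (i : Fin N) := h1_add_ae (Φ i) (h i)
  have h2 (i : Fin N) := h1_add_ae ((2 : ℝ) • Φ i) (h i)
  have h3 (i : Fin N) := h1_smul_ae 2 (Φ i)
  have e1 : densityClass (Φ + h) =ᵐ[volume] density (Φ + h) := AEEqFun.coeFn_mk _ _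
  have e2 : densityClass Φ =ᵐ[volume] density Φ := AEEqFun.coeFn_mk _ _
  filter_upwards [AEEqFun.coeFn_sub (densityClass (Φ + h)) (densityClass Φ), e1, e2,
    ae_all_iff.2 h1, ae_all_iff.2 h2, ae_all_iff.2 h3] with x hs e1 e2 h1 h2 h3
  rw [hs, Pi.sub_apply, e1, e2, density, density, densityMatrix, densityMatrix,
    ← Finset.sum_sub_distrib]
  refine Finset.sum_congr rfl fun i _ => ?_
  rw [h2, h3, Pi.add_apply, h1]
  ring

theorem normL1L3_congr {f g : E3 → ℝ} (h : f =ᵐ[volume] g) : normL1L3 f = normL1L3 g := by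
  rw [normL1L3, normL1L3, eLpNorm_congr_ae h, eLpNorm_congr_ae h]

theorem normL1L3_sum_le {ι : Type*} (s : Finset ι) {f : ι → E3 → ℝ}
    (h1 : ∀ i ∈ s, MemLp (f i) 1 volume) (h3 : ∀ i ∈ s, MemLp (f i) 3 volume) :
    normL1L3 (fun x => ∑ i ∈ s, f i x) ≤ ∑ i ∈ s, normL1L3 (f i) := by
  have hsum : (fun x => ∑ i ∈ s, f i x) = ∑ i ∈ s, f i := by
    ext x; rw [Finset.sum_apply]
  have e1 := eLpNorm_sum_le (μ := volume) (p := 1) (fun i hi => (h1 i hi).1) le_rfl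
  have e3 := eLpNorm_sum_le (μ := volume) (p := 3) (fun i hi => (h1 i hi).1) (by norm_num)
  have f1 := ENNReal.toReal_mono (ENNReal.sum_ne_top.2 fun i hi => (h1 i hi).2.ne) e1
  have f3 := ENNReal.toReal_mono (ENNReal.sum_ne_top.2 fun i hi => (h3 i hi).2.ne) e3
  rw [ENNReal.toReal_sum fun i hi => (h1 i hi).2.ne] at f1
  rw [ENNReal.toReal_sum fun i hi => (h3 i hi).2.ne] at f3
  simp only [normL1L3, hsum, Finset.sum_add_distrib]
  exact add_le_add f1 f3

theorem exists_normL1L3_density_sub_le (Φ : Fin N → H1) : ∃ b : ℝ, 0 ≤ b ∧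
    ∀ h : Fin N → H1, ‖h‖ ≤ 1 →
      normL1L3 (densityClass (Φ + h) - densityClass Φ : E3 →ₘ[volume] ℝ) ≤ b * ‖h‖ := by
  obtain ⟨C, hC0, hC⟩ := exists_normL1L3_mul_le
  refine ⟨N * (C * (2 * ‖Φ‖ + 1)), by positivity, fun h hh => ?_⟩
  rw [normL1L3_congr (densityClass_add_sub_ae Φ h)]
  refine (normL1L3_sum_le Finset.univ (fun i _ => memLp_one_mul _ _)
    (fun i _ => memLp_three_mul _ _)).trans ?_
  have hi (i : Fin N) : normL1L3 (fun x => ((2 : ℝ) • Φ i + h i : H1) x * h i x)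
      ≤ C * (2 * ‖Φ‖ + 1) * ‖h‖ := by
    refine (hC _ _).trans ?_
    have h1 : ‖(2 : ℝ) • Φ i + h i‖ ≤ 2 * ‖Φ‖ + 1 := by
      refine (norm_add_le _ _).trans (add_le_add ?_ ((norm_le_pi_norm h i).trans hh))
      rw [norm_smul, Real.norm_of_nonneg zero_le_two]
      exact mul_le_mul_of_nonneg_left (norm_le_pi_norm Φ i) zero_le_two
    exact mul_le_mul (mul_le_mul_of_nonneg_left h1 hC0) (norm_le_pi_norm h i) (norm_nonneg _)
      (by positivity)
  refine (Finset.sum_le_sum fun i _ => hi i).trans (le_of_eq ?_)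
  rw [Finset.sum_const, Finset.card_univ, Fintype.card_fin, nsmul_eq_mul]
  ring

theorem integral_mul_density_sub {v : E3 → ℝ} (hv : MemDual v) {W : H1 →L[ℝ] H1 →L[ℝ] ℝ}
    (hW : ∀ φ η : H1, W φ η = ∫ x, v x * φ x * η x) (Φ h : Fin N → H1) :
    ∫ x, v x * (densityClass (Φ + h) - densityClass Φ : E3 →ₘ[volume] ℝ) x
      = (∑ i, W ((Φ + h) i) ((Φ + h) i)) - ∑ i, W (Φ i) (Φ i) := by
  have hint := (exists_memDualForm hv).1
  have h1 : ∫ x, v x * (densityClass (Φ + h) - densityClass Φ : E3 →ₘ[volume] ℝ) x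
      = ∫ x, ∑ i, v x * ((2 : ℝ) • Φ i + h i : H1) x * h i x := by
    refine integral_congr_ae ?_
    filter_upwards [densityClass_add_sub_ae Φ h] with x hx
    rw [hx, Finset.mul_sum]
    exact Finset.sum_congr rfl fun i _ => (mul_assoc _ _ _).symm
  have h2 := integral_finsetSum Finset.univ fun i _ => hint ((2 : ℝ) • Φ i + h i) (h i)
  refine h1.trans (h2.trans ?_)
  rw [← Finset.sum_sub_distrib]
  refine Finset.sum_congr rfl fun i _ => ?_
  exact (hW _ _).symm.trans (quadratic_add_sub (symm_of_potentialForm hW) (Φ i) (h i))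

set_option maxHeartbeats 800000 in
/-- The chain rule for the exchange-correlation energy of the density `n_Φ`. -/
theorem hasGradientAt_exc {Exc : (E3 →ₘ[volume] ℝ) → ℝ} {v : E3 → ℝ} {Φ : Fin N → H1}
    (hE : HasXcDerivAt Exc v (densityClass Φ)) {W : H1 →L[ℝ] H1 →L[ℝ] ℝ}
    (hW : ∀ φ η : H1, W φ η = ∫ x, v x * φ x * η x) :
    HasGradientAt (fun Φ : Fin N → H1 => Exc (densityClass Φ)) W Φ := by
  obtain ⟨hv, hE⟩ := hE
  obtain ⟨b, hb0, hb⟩ := exists_normL1L3_density_sub_le Φ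
  refine (hasGradientAt_quadratic (symm_of_potentialForm hW) Φ).congr_of_isLittleO fun ε hε => ?_
  obtain ⟨δ, hδ, hEδ⟩ := hE (ε / (b + 1)) (by positivity)
  have hδ' : 0 < min 1 (δ / (b + 1)) := lt_min one_pos (by positivity)
  filter_upwards [Metric.ball_mem_nhds (0 : Fin N → H1) hδ'] with h hh
  have hh1 : ‖h‖ < min 1 (δ / (b + 1)) := mem_ball_zero_iff.1 hh
  have hn := hb h (hh1.le.trans (min_le_left _ _))
  have hn0 : 0 ≤ ‖h‖ := norm_nonneg h
  have hh2 : ‖h‖ * (b + 1) < δ :=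
    (lt_div_iff₀ (by positivity)).1 (hh1.trans_le (min_le_right _ _))
  have key := hEδ _ (densityClass_mem_densities (Φ + h)) (hn.trans (by linarith))
  rw [integral_mul_density_sub hv hW Φ h] at key
  refine key.trans ((mul_le_mul_of_nonneg_left hn (by positivity)).trans ?_)
  have hle : b / (b + 1) ≤ 1 := (div_le_one (by positivity)).2 (by linarith)
  calc ε / (b + 1) * (b * ‖h‖) = ε * ‖h‖ * (b / (b + 1)) := by ring
    _ ≤ ε * ‖h‖ := mul_le_of_le_one_right (by positivity) hle

theorem integral_density_mul_nuclear (Z : Fin M → ℝ) (R : Fin M → E3) (Φ : Fin N → H1) :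
    Integrable (fun x => density Φ x * nuclearPotential Z R x) volume ∧
      ∫ x, density Φ x * nuclearPotential Z R x
        = ∑ i, ∫ x, nuclearPotential Z R x * Φ i x * Φ i x := by
  have hi (i : Fin N) := (exists_nuclearForm Z R).1 (Φ i) (Φ i)
  have heq (x : E3) : ∑ i, nuclearPotential Z R x * Φ i x * Φ i x
      = density Φ x * nuclearPotential Z R x := by
    rw [density, densityMatrix, Finset.sum_mul]
    exact Finset.sum_congr rfl fun i _ => by ring
  exact ⟨(integrable_finsetSum Finset.univ fun i _ => hi i).congr (Eventually.of_forall heq),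
    (integral_congr_ae (Eventually.of_forall heq)).symm.trans
      (integral_finsetSum Finset.univ fun i _ => hi i)⟩

theorem integral_density_mul_density (Φ : Fin N → H1) :
    Integrable (fun x => ∫ y, density Φ x * density Φ y / ‖x - y‖) volume ∧
      ∫ x, ∫ y, density Φ x * density Φ y / ‖x - y‖
        = ∑ i, ∑ j, coulombForm (Φ j) (Φ j) (Φ i) (Φ i) := by
  have hi (i : Fin N) := integral_coulomb_density_mul Φ (Φ i) (Φ i)
  have heq (x : E3) : ∑ i, coulomb (density Φ) x * Φ i x * Φ i x
      = ∫ y, density Φ x * density Φ y / ‖x - y‖ := by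
    have h1 : ∫ y, density Φ x * density Φ y / ‖x - y‖ = density Φ x * coulomb (density Φ) x := by
      rw [coulomb, ← integral_const_mul]
      exact integral_congr_ae (Eventually.of_forall fun y => mul_div_assoc _ _ _)
    rw [h1]
    conv_rhs => rw [density, densityMatrix, Finset.sum_mul]
    exact Finset.sum_congr rfl fun i _ => by ring
  exact ⟨(integrable_finsetSum Finset.univ fun i _ => (hi i).1).congr (Eventually.of_forall heq),
    (integral_congr_ae (Eventually.of_forall heq)).symm.trans
      ((integral_finsetSum Finset.univ fun i _ => (hi i).1).trans
        (Finset.sum_congr rfl fun i _ => (hi i).2))⟩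

theorem kohnSham_eq (Z : Fin M → ℝ) (R : Fin M → E3) (Exc : (E3 →ₘ[volume] ℝ) → ℝ)
    {K V : H1 →L[ℝ] H1 →L[ℝ] ℝ}
    (hK : ∀ φ η : H1, K φ η = ∫ x, inner ℝ (grad φ x) (grad η x))
    (hV : ∀ φ η : H1, V φ η = ∫ x, nuclearPotential Z R x * φ x * η x) (Φ : Fin N → H1) :
    kohnSham Z R Exc Φ = orbitalEnergy K V coulombForm 0 Φ + Exc (densityClass Φ) := by
  have hK' (φ : H1) : K φ φ = ∫ x, ‖grad φ x‖ ^ 2 :=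
    (hK φ φ).trans (integral_congr_ae (Eventually.of_forall fun _ => real_inner_self_eq_norm_sq _))
  rw [kohnSham, (integral_density_mul_nuclear Z R Φ).2, (integral_density_mul_density Φ).2]
  simp only [orbitalEnergy, hK', hV, zero_mul, sub_zero]

theorem isKohnShamOperator_of_forall (Z : Fin M → ℝ) (R : Fin M → E3) {v : E3 → ℝ}
    (hv : MemDual v) {K V W : H1 →L[ℝ] H1 →L[ℝ] ℝ}
    (hK : ∀ φ η : H1, K φ η = ∫ x, inner ℝ (grad φ x) (grad η x))
    (hV : ∀ φ η : H1, V φ η = ∫ x, nuclearPotential Z R x * φ x * η x)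
    (hW : ∀ φ η : H1, W φ η = ∫ x, v x * φ x * η x) (Φ : Fin N → H1)
    {A : H1 →L[ℝ] H1 →L[ℝ] ℝ} (hA : ∀ φ η, A φ η = 1 / 2 * K φ η + V φ η
      + ∑ j, coulombForm (Φ j) (Φ j) φ η + W φ η) :
    IsKohnShamOperator Z R v Φ A := by
  intro φ η
  have i0 := (exists_nuclearForm Z R).1 φ η
  obtain ⟨i1, e1⟩ := integral_coulomb_density_mul Φ φ η
  have i2 := (exists_memDualForm hv).1 φ η
  have heq (x : E3) : nuclearPotential Z R x * φ x * η x + coulomb (density Φ) x * φ x * η x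
      + v x * φ x * η x = (nuclearPotential Z R x * φ x + coulomb (density Φ) x * φ x
      + v x * φ x) * η x := by ring
  refine ⟨((i0.add i1).add i2).congr (Eventually.of_forall heq), ?_⟩
  have h : ∫ x, (nuclearPotential Z R x * φ x + coulomb (density Φ) x * φ x
      + v x * φ x) * η x = (∫ x, nuclearPotential Z R x * φ x * η x)
        + (∑ j, coulombForm (Φ j) (Φ j) φ η) + ∫ x, v x * φ x * η x :=
    (integral_congr_ae (Eventually.of_forall heq)).symm.trans
      ((integral_add (i0.add i1) i2).trans
        (congrArg₂ (· + ·) ((integral_add i0 i1).trans (congrArg _ e1)) rfl))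
  refine (hA φ η).trans (Eq.trans ?_ (congrArg _ h.symm))
  have hKe := hK φ η
  have hVe := hV φ η
  have hWe := hW φ η
  linarith

set_option maxHeartbeats 800000 in
/-- The Kohn–Sham functional is differentiable with the Kohn–Sham Hamiltonian as gradient operator,
and its minimizers satisfy the canonical Kohn–Sham equations. -/
theorem kohnSham_canonical (N : ℕ) (Z : Fin M → ℝ) (R : Fin M → E3)
    (Exc : (E3 →ₘ[volume] ℝ) → ℝ) (vxc : (E3 →ₘ[volume] ℝ) → E3 → ℝ)
    (hxc : ∀ n ∈ densities, HasXcDerivAt Exc (vxc n) n) :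
    ∃ A : (Fin N → H1) → H1 →L[ℝ] Hneg1,
      (∀ Φ, IsKohnShamOperator Z R (vxc (densityClass Φ)) Φ (A Φ)) ∧
      HasGradientOperator (kohnSham Z R Exc) A ∧
      CanonicalEquations (kohnSham Z R Exc) A := by
  obtain ⟨K, hK⟩ := exists_kineticForm
  obtain ⟨-, V, hV⟩ := exists_nuclearForm Z R
  have hxc' (Φ : Fin N → H1) := hxc _ (densityClass_mem_densities Φ)
  choose W hW using fun Φ : Fin N → H1 => (exists_memDualForm (hxc' Φ).1).2
  have hJ : kohnSham Z R Exc = fun Φ : Fin N → H1 =>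
      orbitalEnergy K V coulombForm 0 Φ + Exc (densityClass Φ) :=
    funext (kohnSham_eq Z R Exc hK hV)
  obtain ⟨A, hA, hgrad, hsymm, hinv, hAinv⟩ := exists_orbitalEnergy_gradient (N := N) 0
    (symm_of_kineticForm hK) (symm_of_potentialForm hV) isBoundedQuadrilinear_coulombForm
    coulombForm_swap coulombForm_comm
  have hgrad' (Φ : Fin N → H1) := (hgrad Φ).add (hasGradientAt_exc (hxc' Φ) (hW Φ))
  rw [hJ]
  refine ⟨fun Φ => A Φ + W Φ, fun Φ => isKohnShamOperator_of_forall Z R (hxc' Φ).1 hK hV (hW Φ) Φ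
    fun φ η => ?_, hasGradientOperator_of_hasGradientAt hgrad',
    canonicalEquations_of_invariant hgrad' (fun Φ φ η => ?_) (fun Φ U hU => ?_)
      (fun Φ U hU => ?_)⟩
  · exact (add_bilin_apply _ _ φ η).trans
      (congrArg₂ (· + ·) ((hA Φ φ η).trans (sub_zero_mul _ _)) rfl)
  · exact (add_bilin_apply _ _ φ η).trans ((congrArg₂ (· + ·) (hsymm Φ φ η)
      (symm_of_potentialForm (hW Φ) φ η)).trans (add_bilin_apply _ _ η φ).symm)
  · exact congrArg₂ (· + ·) (hinv Φ U hU) (congrArg Exc (densityClass_rightMul Φ hU))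
  · refine congrArg₂ (· + ·) (hAinv Φ U hU) ?_
    ext φ η
    refine (hW _ φ η).trans (Eq.trans ?_ (hW Φ φ η).symm)
    rw [densityClass_rightMul Φ hU]

end Functionals

/-! ### The density matrix of the Slater determinant -/

theorem slater_eq {N : ℕ} (Φ : Fin N → H1) (x : Fin N → E3) :
    slater Φ x = 1 / √(N.factorial : ℝ)
      * ∑ σ : Equiv.Perm (Fin N), (Equiv.Perm.sign σ : ℝ) * ∏ j, Φ (σ j) (x j) := by
  rw [slater, Matrix.det_apply']
  simp

theorem sum_perm_zero {n : ℕ} (f : Fin (n + 1) → ℝ) :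
    ∑ σ : Equiv.Perm (Fin (n + 1)), f (σ 0) = n.factorial * ∑ i, f i := by
  rw [← Equiv.sum_comp (Equiv.Perm.decomposeFin (n := n)).symm, Fintype.sum_prod_type]
  simp [Finset.mul_sum, Fintype.card_perm]

theorem perm_eq_of_succ {n : ℕ} {σ τ : Equiv.Perm (Fin (n + 1))}
    (h : ∀ j : Fin n, σ j.succ = τ j.succ) : σ = τ := by
  have h0 : σ 0 = τ 0 := by
    obtain ⟨k, hk⟩ := σ.surjective (τ 0)
    rcases Fin.eq_zero_or_eq_succ k with rfl | ⟨j, rfl⟩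
    · exact hk
    · rw [h] at hk
      exact absurd (τ.injective hk) (Fin.succ_ne_zero j)
  ext k
  rcases Fin.eq_zero_or_eq_succ k with rfl | ⟨j, rfl⟩
  · rw [h0]
  · rw [h]

/-- Expanding both determinants, orthonormality leaves only the diagonal terms. -/
theorem slaterDensityMatrix_eq {N : ℕ} {Φ : Fin N → H1} (hΦ : Φ ∈ stiefel N) (x y : E3) :
    slaterDensityMatrix Φ x y = densityMatrix Φ x y := by
  cases N with
  | zero => simp [slaterDensityMatrix, densityMatrix]
  | succ n =>
    let g (σ τ : Equiv.Perm (Fin (n + 1))) (z : Fin n → E3) : ℝ :=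
      ((Equiv.Perm.sign σ : ℝ) * (Equiv.Perm.sign τ : ℝ) * (Φ (σ 0) x * Φ (τ 0) y))
        * ∏ j, Φ (σ j.succ) (z j) * Φ (τ j.succ) (z j)
    have hg (σ τ) : Integrable (g σ τ) volume := by
      refine Integrable.const_mul ?_ _
      exact Integrable.fintype_prod fun j =>
        memLp_one_iff_integrable.1 (memLp_one_mul (Φ (σ (Fin.succ j))) (Φ (τ (Fin.succ j))))
    have hgi (σ τ) : ∫ z, g σ τ z = if σ = τ then Φ (σ 0) x * Φ (σ 0) y else 0 := by
      have h1 : ∫ z, g σ τ z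
          = ((Equiv.Perm.sign σ : ℝ) * (Equiv.Perm.sign τ : ℝ) * (Φ (σ 0) x * Φ (τ 0) y))
            * ∏ j : Fin n, (if σ j.succ = τ j.succ then (1 : ℝ) else 0) := by
        refine (integral_const_mul _ _).trans (congrArg _ ?_)
        refine (integral_fintype_prod_volume_eq_prod
          (fun j z => Φ (σ (Fin.succ j)) z * Φ (τ (Fin.succ j)) z)).trans ?_
        exact Finset.prod_congr rfl fun j _ => hΦ _ _
      rw [h1]
      split_ifs with h
      · subst h
        have : (Equiv.Perm.sign σ : ℝ) * (Equiv.Perm.sign σ : ℝ) = 1 := by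
          rcases Int.units_eq_one_or (Equiv.Perm.sign σ) with h | h <;> simp [h]
        simp [this]
      · obtain ⟨j, hj⟩ : ∃ j : Fin n, σ j.succ ≠ τ j.succ := by
          by_contra hcon
          push Not at hcon
          exact h (perm_eq_of_succ hcon)
        rw [Finset.prod_eq_zero (Finset.mem_univ j) (if_neg hj), mul_zero]
    have hprod (z : Fin n → E3) : slater Φ (Fin.cons x z) * slater Φ (Fin.cons y z)
        = 1 / ((n + 1).factorial : ℝ) * ∑ σ, ∑ τ, g σ τ z := by
      have hs : (1 / √((n + 1).factorial : ℝ)) * (1 / √((n + 1).factorial : ℝ))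
          = 1 / ((n + 1).factorial : ℝ) := by
        rw [div_mul_div_comm, Real.mul_self_sqrt (by positivity), one_mul]
      rw [slater_eq, slater_eq, mul_mul_mul_comm, hs, Finset.sum_mul_sum]
      refine congrArg _ (Finset.sum_congr rfl fun σ _ => Finset.sum_congr rfl fun τ _ => ?_)
      simp only [g, Fin.prod_univ_succ, Fin.cons_zero, Fin.cons_succ, Finset.prod_mul_distrib]
      ring
    have hint : ∫ z : Fin n → E3, slater Φ (Fin.cons x z) * slater Φ (Fin.cons y z)
        = 1 / ((n + 1).factorial : ℝ) * ∑ σ, ∑ τ, ∫ z, g σ τ z := by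
      refine (integral_congr_ae (Eventually.of_forall hprod)).trans
        ((integral_const_mul _ _).trans (congrArg _ ?_))
      refine (integral_finsetSum Finset.univ fun σ _ =>
        integrable_finsetSum Finset.univ fun τ _ => hg σ τ).trans ?_
      exact Finset.sum_congr rfl fun σ _ => integral_finsetSum Finset.univ fun τ _ => hg σ τ
    have hfac : (n.factorial : ℝ) ≠ 0 := by positivity
    rw [slaterDensityMatrix, hint]
    simp only [hgi, Finset.sum_ite_eq, Finset.mem_univ, if_true]
    rw [sum_perm_zero fun i => Φ i x * Φ i y, densityMatrix, Nat.factorial_succ]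
    push_cast
    field_simp

end HFKS

theorem proposition3p1 (N M : ℕ) (Z : Fin M → ℝ) (R : Fin M → HFKS.E3) :
    -- all the Coulomb integrals occurring in the functionals and operators exist
    ((∀ (φ η : HFKS.H1) (x : HFKS.E3),
        Integrable (fun y => φ y * η y / ‖x - y‖) volume) ∧
      (∀ (Φ : Fin N → HFKS.H1) (i : Fin N),
        Integrable (HFKS.hfIntegrand Z R Φ i) volume) ∧
      (∀ Φ : Fin N → HFKS.H1,
        Integrable (fun x => HFKS.density Φ x * HFKS.nuclearPotential Z R x)
          volume ∧
        Integrable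
          (fun x => ∫ y, HFKS.density Φ x * HFKS.density Φ y / ‖x - y‖)
          volume)) ∧
    -- the density matrix of the Slater determinant
    (∀ Φ ∈ HFKS.stiefel N, ∀ x y : HFKS.E3,
      HFKS.slaterDensityMatrix Φ x y = HFKS.densityMatrix Φ x y) ∧
    -- Hartree–Fock
    (∃ A : (Fin N → HFKS.H1) → HFKS.H1 →L[ℝ] HFKS.Hneg1,
      (∀ Φ, HFKS.IsFockOperator Z R Φ (A Φ)) ∧
      HFKS.HasGradientOperator (HFKS.hartreeFock Z R) A ∧
      HFKS.CanonicalEquations (HFKS.hartreeFock Z R) A) ∧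
    -- Kohn–Sham
    (∀ (Exc : (HFKS.E3 →ₘ[volume] ℝ) → ℝ)
      (vxc : (HFKS.E3 →ₘ[volume] ℝ) → HFKS.E3 → ℝ),
      (∀ n ∈ HFKS.densities, HFKS.HasXcDerivAt Exc (vxc n) n) →
      ∃ A : (Fin N → HFKS.H1) → HFKS.H1 →L[ℝ] HFKS.Hneg1,
        (∀ Φ, HFKS.IsKohnShamOperator Z R (vxc (HFKS.densityClass Φ)) Φ (A Φ)) ∧
        HFKS.HasGradientOperator (HFKS.kohnSham Z R Exc) A ∧
        HFKS.CanonicalEquations (HFKS.kohnSham Z R Exc) A) := by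
  exact ⟨⟨fun φ η x => HFKS.integrable_coulomb φ η x, HFKS.integrable_hfIntegrand Z R, fun Φ =>
    ⟨(HFKS.integral_density_mul_nuclear Z R Φ).1, (HFKS.integral_density_mul_density Φ).1⟩⟩,
    fun _ hΦ x y => HFKS.slaterDensityMatrix_eq hΦ x y,
    HFKS.hartreeFock_canonical N Z R, HFKS.kohnSham_canonical N Z R⟩
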